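/- **Fundamental Relation.** Let $r\ge 1$, let $F$ be a number field with adele ring $\mathbb A$, and let $G=GL_r$. For $g=(g_f;g_\infty)\in G(\mathbb A)$ let $E_g=\{x\in F^r: g_v^{-1}x\in\mathcal O_v^r\text{ for all finite }v\}$, and let $\Lambda^g$ be the $\mathcal O_F$-lattice $E_g$ whose metric at each infinite place $\sigma$ is the standard one on $F_\sigma^r$ transported by $g_\sigma$, i.e. $\|x\|_\sigma=|g_\sigma^{-1}x|$. For an $\mathcal O_F$-lattice $L$ of rank $k$ put $\deg L=-\log\big(2^{r_2k}\,\mathrm{Vol}_{\mathrm{Leb}}(L)\big)+\frac k2\log|\Delta_F|$, where $r_2$ is the number of complex places of $F$ and $\mathrm{Vol}_{\mathrm{Leb}}$ is the covolume for the real inner product $\sum_\sigma\mathrm{Re}\langle\cdot,\cdot\rangle_\sigma$; put $\mu(L)=\deg L/k$ if $k\geq 1$. Sublattices of $\Lambda^g$ are the $\Lambda^g_W=E_g\cap W$ with $W\subseteq F^r$ an $F$-subspace, with the restricted metrics; quotients carry the orthogonal projection metrics. To a filtration $0=W_0\subsetneq W_1\subsetneq\dots\subsetneq W_s=F^r$ attach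 its polygon with respect to $g$: the function on $[0,r]$ that is affine on each $[\dim W_{i-1},\dim W_i]$ and takes the value $\deg\Lambda^g_{W_i}-\frac{\dim W_i}{r}\deg\Lambda^g$ at $\dim W_i$, $0\le i\le s$. The canonical (Harder–Narasimhan) filtration of $\Lambda^g$ is the one for which the successive quotients $\Lambda^g_{W_i}/\Lambda^g_{W_{i-1}}$ are semistable (no nonzero sublattice has a larger slope $\mu$) and have strictly decreasing slopes; it exists and is unique. Let $\overline p^g$ be its polygon. For a standard parabolic subgroup $P$ of $G$, i.e. the block upper triangular matrices of a partition (composition) $r=d_1+\dots+d_{|P|}$, put $r_i=d_1+\dots+d_i$ and let $p_P^g$ be the polygon of $0\subset F^{r_1}\subset F^{r_2}\subset\dots\subset F^r$ (spans of the first $r_i$ standard basis vectors). For functions $p,q$ on $[0,r]$ write $q>_Pp$ if $q(r_i)>p(r_i)$ for $i=1,\dots,|P|-1$. Write $\mathbf 1(A)$ for $1$ if $A$ holds and $0$ otherwise. Let $p:[0,r]\to\mathbb R$ be a convex normalized polygon, i.e. a continuous, piecewise affine function with decreasing slopes (so the region below its graph is convex) and $p(0)=p(r)=0$. Then for every $g\in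 G(\mathbb A)$ $$\mathbf 1(\overline p^g\le p)=\sum_{P\ \text{standard parabolic}}(-1)^{|P|-1}\sum_{\delta\in P(F)\backslash G(F)}\mathbf 1(p_P^{\delta g}>_Pp),$$ where the terms depend only on the coset of $\delta$ and each inner sum has only finitely many nonzero terms. If $F=\mathbb Q$, the same holds with $P(\mathbb Z)\backslash G(\mathbb Z)$ in place of $P(\mathbb Q)\backslash G(\mathbb Q)$: $$\mathbf 1(\overline p^g\le p)=\sum_{P\ \text{standard parabolic}}(-1)^{|P|-1}\sum_{\delta\in P(\mathbb Z)\backslash G(\mathbb Z)}\mathbf 1(p_P^{\delta g}>_Pp)\qquad\forall g\in GL_r(\mathbb A_{\mathbb Q}).$$ -/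

import Mathlib

open scoped MatrixGroups NumberField NumberField.AdeleRing

noncomputable section

namespace LatticeTruncation

open IsDedekindDomain Module

/-! ### Polygons -/

/-- A polygon on `[0, r]`: a function that is affine on each interval of some finite subdivision
`0 = t 0 ≤ t 1 ≤ ⋯ ≤ t n = r` (in particular it is continuous on `[0, r]`). -/
def IsPolygon (r : ℕ) (p : ℝ → ℝ) : Prop :=
  ∃ (n : ℕ) (t : Fin (n + 1) → ℝ), Monotone t ∧ t 0 = 0 ∧ t (Fin.last n) = r ∧
    ∀ i : Fin n, ∃ a b : ℝ, ∀ x ∈ Set.Icc (t i.castSucc) (t i.succ), p x = a * x + b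

/-- A convex normalized polygon on `[0, r]`. "Convex" is used here as for Harder-Narasimhan
polygons: the region below the graph is convex, i.e. the slopes decrease from left to right. -/
structure IsConvexNormalizedPolygon (r : ℕ) (p : ℝ → ℝ) : Prop where
  isPolygon : IsPolygon r p
  concaveOn : ConcaveOn ℝ (Set.Icc (0 : ℝ) r) p
  map_zero : p 0 = 0
  map_rank : p r = 0

/-! ### Filtrations, standard parabolic subgroups -/

/-- A filtration `0 = W 0 < W 1 < ⋯ < W s = F ^ r` by `F`-subspaces. These correspond to the
(standard and nonstandard) parabolic subgroups of `GL_r` over `F`. -/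
structure Filtration (F : Type*) [Field F] (r : ℕ) where
  /-- the number `s` of steps -/
  length : ℕ
  /-- the subspaces -/
  space : Fin (length + 1) → Submodule F (Fin r → F)
  strictMono : StrictMono space
  space_zero : space 0 = ⊥
  space_last : space (Fin.last length) = ⊤

/-- The span of the first `k` standard basis vectors of `F ^ r`. -/
def coordSpace (F : Type*) [Field F] (r k : ℕ) : Submodule F (Fin r → F) where
  carrier := {x | ∀ j : Fin r, k ≤ (j : ℕ) → x j = 0}
  add_mem' hx hy j hj := by simp [hx j hj, hy j hj]
  zero_mem' _ _ := rfl
  smul_mem' a x hx j hj := by simp [hx j hj]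

theorem coordSpace_mono (F : Type*) [Field F] (r : ℕ) : Monotone (coordSpace F r) :=
  fun _ _ hkl _ hx j hj => hx j (hkl.trans hj)

theorem coordSpace_lt (F : Type*) [Field F] {r k l : ℕ} (hkl : k < l) (hl : l ≤ r) :
    coordSpace F r k < coordSpace F r l := by
  refine lt_of_le_of_ne (coordSpace_mono F r hkl.le) fun h => ?_
  have hmem : (Pi.single (⟨k, hkl.trans_le hl⟩ : Fin r) (1 : F)) ∈ coordSpace F r l := by
    intro j hj
    refine Pi.single_eq_of_ne ?_ _
    rintro rfl
    exact absurd hj (by simpa using hkl)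
  rw [← h] at hmem
  have := hmem ⟨k, hkl.trans_le hl⟩ le_rfl
  simp at this

/-- The filtration `0 ⊂ F ^ r₁ ⊂ F ^ r₂ ⊂ ⋯ ⊂ F ^ r`, `rᵢ = d₁ + ⋯ + dᵢ`, attached to the
standard parabolic subgroup of the partition `r = d₁ + ⋯ + dₙ`. -/
def stdFiltration (F : Type*) [Field F] {r : ℕ} (c : Composition r) : Filtration F r where
  length := c.length
  space i := coordSpace F r (c.sizeUpTo i)
  strictMono := by
    refine Fin.strictMono_iff_lt_succ.2 fun i => ?_
    exact coordSpace_lt F (c.sizeUpTo_strict_mono i.2) (c.sizeUpTo_le _)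
  space_zero := by
    refine eq_bot_iff.2 fun x hx => ?_
    ext j
    exact hx j (by simp)
  space_last := by
    refine eq_top_iff.2 fun x _ j hj => ?_
    simp only [Fin.val_last, Composition.sizeUpTo_length] at hj
    exact absurd j.2 (not_lt.2 hj)

/-- The `R`-points of the standard parabolic subgroup of `GL_r` attached to the partition
`r = d₁ + ⋯ + dₙ`: block upper triangular matrices with diagonal blocks of sizes `d₁, …, dₙ`. -/
def stdParabolic (R : Type*) [CommRing R] {r : ℕ} (c : Composition r) :
    Subgroup (GL (Fin r) R) where
  carrier := {γ | (γ : Matrix (Fin r) (Fin r) R).BlockTriangular c.index}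
  mul_mem' hx hy := by
    simpa using Matrix.BlockTriangular.mul hx hy
  one_mem' := by
    simpa using Matrix.blockTriangular_one
  inv_mem' := by
    intro γ hγ
    have := γ.isUnit.invertible
    simpa [Matrix.coe_units_inv] using Matrix.blockTriangular_inv_of_blockTriangular hγ

theorem coordSpace_of_blockTriangular {F : Type*} [Field F] {r : ℕ} {c : Composition r} {γ : GL (Fin r) F}
    (hγ : γ ∈ stdParabolic F c) {k : ℕ} {x : Fin r → F}
    (hx : x ∈ coordSpace F r (c.sizeUpTo k)) :
    (γ : Matrix (Fin r) (Fin r) F).mulVec x ∈ coordSpace F r (c.sizeUpTo k) := by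
  intro i hi
  change ∑ j, (γ : Matrix (Fin r) (Fin r) F) i j * x j = 0
  refine Finset.sum_eq_zero fun j _ => ?_
  by_cases hj : c.sizeUpTo k ≤ (j : ℕ)
  · rw [hx j hj, mul_zero]
  · have h1 : c.index j < c.index i := by
      by_contra! h
      have h2 : (c.index j : ℕ) < k := by
        by_contra! h3
        exact hj ((c.monotone_sizeUpTo h3).trans (c.sizeUpTo_index_le j))
      have h4 : (c.index i : ℕ) + 1 ≤ k := by
        have : (c.index i : ℕ) ≤ c.index j := h
        omega
      have h5 := c.lt_sizeUpTo_index_succ i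
      have h6 := c.monotone_sizeUpTo h4
      simp only [Fin.val_succ] at h5
      omega
    have h0 : (γ : Matrix (Fin r) (Fin r) F) i j = 0 := hγ h1
    rw [h0, zero_mul]

/-! ### The lattice attached to an adelic matrix -/

section Lattice

variable {F : Type*} [Field F] [NumberField F] {r : ℕ}

/-- The Euclidean space `(ℂ ^ r) ^ S∞` with the real inner product `∑ Re (u * conj w)`. It
contains `∏_σ F_σ ^ r` (where a real completion sits in `ℂ` as `ℝ`), with the standard inner
product at each real place and the real part of the standard Hermitian product at each complex
place. -/
abbrev Ambient (F : Type*) [Field F] (r : ℕ) : Type _ :=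
  PiLp 2 (fun _ : NumberField.InfinitePlace F × Fin r => ℂ)

/-- The diagonal map `GL_r(F) → GL_r(𝔸_F)`, more generally for an `R` mapping to `F`. -/
def toAdelic (R F : Type*) [CommRing R] [Field F] [NumberField F] [Algebra R F] (r : ℕ) :
    GL (Fin r) R →* GL (Fin r) 𝔸[F] :=
  Matrix.GeneralLinearGroup.map ((algebraMap F 𝔸[F]).comp (algebraMap R F))

/-- `x ↦ g⁻¹ x`, from `F ^ r` to `𝔸_F ^ r`. -/
def adelicCoord (g : GL (Fin r) 𝔸[F]) : (Fin r → F) →+ (Fin r → 𝔸[F]) where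
  toFun x := ((g⁻¹ : GL (Fin r) 𝔸[F]) : Matrix (Fin r) (Fin r) 𝔸[F]).mulVec
    fun j => algebraMap F 𝔸[F] (x j)
  map_zero' := by
    ext i : 1
    simp [Matrix.mulVec, dotProduct]
  map_add' x y := by
    rw [← Matrix.mulVec_add]
    congr 1
    ext j : 1
    simp

/-- The module `E_g = {x ∈ F ^ r | g_v⁻¹ x ∈ 𝒪_v ^ r for all finite v}`, i.e. the projective
`𝒪_F`-module of rank `r` whose localization at each finite place `v` is `g_v 𝒪_v ^ r`. -/
def vectorSheaf (g : GL (Fin r) 𝔸[F]) : Submodule ℤ (Fin r → F) where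
  carrier := {x | ∀ (v : HeightOneSpectrum (𝓞 F)) (i : Fin r),
    (adelicCoord g x i).2 v ∈ v.adicCompletionIntegers F}
  add_mem' {x y} hx hy v i := by
    rw [map_add]
    exact add_mem (hx v i) (hy v i)
  zero_mem' v i := by
    rw [map_zero]
    exact zero_mem (v.adicCompletionIntegers F)
  smul_mem' n x hx v i := by
    rw [map_zsmul]
    exact zsmul_mem (hx v i) n

/-- The embedding of `F ^ r` into the archimedean space, `x ↦ (g_σ⁻¹ x)_σ`. Pulling back the
inner product gives the metric that is obtained from the standard one by transport through the
linear maps `g_σ`. -/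
def archEmbedding (g : GL (Fin r) 𝔸[F]) : (Fin r → F) →+ Ambient F r where
  toFun x := WithLp.toLp 2 fun a =>
    NumberField.InfinitePlace.Completion.extensionEmbedding a.1 ((adelicCoord g x a.2).1 a.1)
  map_zero' := by
    ext a
    rw [map_zero]
    exact map_zero (NumberField.InfinitePlace.Completion.extensionEmbedding a.1)
  map_add' x y := by
    ext a
    rw [map_add]
    exact map_add (NumberField.InfinitePlace.Completion.extensionEmbedding a.1) _ _

/-- The sublattice `Λ^g_W = E_g ∩ W` of `Λ^g` cut out by a subspace `W` of `F ^ r`, as a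
`ℤ`-lattice in a Euclidean space; `Λ^g` itself is `lattice g ⊤`. -/
def lattice (g : GL (Fin r) 𝔸[F]) (W : Submodule F (Fin r → F)) : Submodule ℤ (Ambient F r) :=
  (vectorSheaf g ⊓ W.restrictScalars ℤ).map (archEmbedding g).toIntLinearMap

/-- The quotient lattice `Λ^g_W' / Λ^g_W`: the image of `Λ^g_W'` under the orthogonal projection to
the orthogonal complement of the real span of `Λ^g_W`. -/
def quotientLattice (g : GL (Fin r) 𝔸[F]) (W W' : Submodule F (Fin r → F)) :
    Submodule ℤ (Ambient F r) :=
  (lattice g W').map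
    ((Submodule.span ℝ (lattice g W : Set (Ambient F r)))ᗮ.starProjection.toLinearMap.restrictScalars
      ℤ)

/-- The Lebesgue volume of a lattice: the covolume in its own real span, for the Lebesgue measure
of the induced inner product. -/
def lebesgueVolume (L : Submodule ℤ (Ambient F r)) : ℝ :=
  ZLattice.covolume
    (L.comap ((Submodule.span ℝ (L : Set (Ambient F r))).subtype.restrictScalars ℤ))
    MeasureTheory.volume

/-- The canonical volume `2 ^ (r₂ k) * Vol_Leb(L)` of an `𝒪_F`-lattice `L` of `𝒪_F`-rank `k`. -/
def canonicalVolume (k : ℕ) (L : Submodule ℤ (Ambient F r)) : ℝ :=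
  2 ^ (NumberField.InfinitePlace.nrComplexPlaces F * k) * lebesgueVolume L

/-- The Arakelov degree `-log Vol(L) + (k / 2) log |Δ_F|` of an `𝒪_F`-lattice `L` of
`𝒪_F`-rank `k`. -/
def degree (k : ℕ) (L : Submodule ℤ (Ambient F r)) : ℝ :=
  -Real.log (canonicalVolume k L) + (k : ℝ) / 2 * Real.log |(NumberField.discr F : ℝ)|

/-- The degree of the sublattice `Λ^g_W`. -/
def subDegree (g : GL (Fin r) 𝔸[F]) (W : Submodule F (Fin r → F)) : ℝ :=
  degree (finrank F W) (lattice g W)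

/-- The slope `μ(Λ^g_W' / Λ^g_W)`, for `W < W'`. -/
def slope (g : GL (Fin r) 𝔸[F]) (W W' : Submodule F (Fin r → F)) : ℝ :=
  degree (finrank F W' - finrank F W) (quotientLattice g W W') /
    ((finrank F W' - finrank F W : ℕ) : ℝ)

/-- Semistability of `Λ^g_W' / Λ^g_W`, for `W < W'`: no nonzero sublattice has a larger slope. The
sublattices are the `Λ^g_U / Λ^g_W` with `W ≤ U ≤ W'`. -/
def IsSemistable (g : GL (Fin r) 𝔸[F]) (W W' : Submodule F (Fin r → F)) : Prop :=
  ∀ U : Submodule F (Fin r → F), W < U → U ≤ W' → slope g W U ≤ slope g W W'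

/-- The filtration of `Λ^g` cut out by `𝓕` is the canonical (Harder-Narasimhan) one: the
successive quotients are semistable, with strictly decreasing slopes. -/
structure IsCanonical (g : GL (Fin r) 𝔸[F]) (𝓕 : Filtration F r) : Prop where
  semistable : ∀ i : Fin 𝓕.length, IsSemistable g (𝓕.space i.castSucc) (𝓕.space i.succ)
  slope_anti : StrictAnti fun i : Fin 𝓕.length => slope g (𝓕.space i.castSucc) (𝓕.space i.succ)

/-- The height of the vertex of the polygon that belongs to a subspace `W`:
`deg Λ^g_W - rk Λ^g_W * deg Λ^g / r`. -/
def vertex (g : GL (Fin r) 𝔸[F]) (W : Submodule F (Fin r → F)) : ℝ :=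
  subDegree g W - (finrank F W : ℝ) * (subDegree g ⊤ / r)

/-- The polygon `[0, r] → ℝ` of the filtration of `Λ^g` cut out by `𝓕`: it vanishes at `0`, is
affine on each `[rk Wᵢ, rk Wᵢ₊₁]`, and takes the value `vertex g Wᵢ` at `rk Wᵢ`. The `i`-th summand
is the increment of the polygon over the part of `[rk Wᵢ, rk Wᵢ₊₁]` to the left of `x`. -/
def polygon (g : GL (Fin r) 𝔸[F]) (𝓕 : Filtration F r) (x : ℝ) : ℝ :=
  ∑ i : Fin 𝓕.length,
    (vertex g (𝓕.space i.succ) - vertex g (𝓕.space i.castSucc)) /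
        ((finrank F (𝓕.space i.succ) : ℝ) - finrank F (𝓕.space i.castSucc)) *
      (min (max x (finrank F (𝓕.space i.castSucc))) (finrank F (𝓕.space i.succ)) -
        finrank F (𝓕.space i.castSucc))

open Classical in
/-- The canonical polygon of `Λ^g`: the polygon of the canonical filtration. -/
def canonicalPolygon (g : GL (Fin r) 𝔸[F]) : ℝ → ℝ :=
  if h : ∃ 𝓕 : Filtration F r, IsCanonical g 𝓕 then polygon g h.choose else 0

/-- `q >_P p`, for the standard parabolic subgroup `P` of the partition `c`: `q rᵢ > p rᵢ` for
`i = 1, …, |P| - 1`. -/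
def BiggerWrt {r : ℕ} (c : Composition r) (q p : ℝ → ℝ) : Prop :=
  ∀ i : ℕ, 1 ≤ i → i < c.length → p (c.sizeUpTo i) < q (c.sizeUpTo i)

/-! ### Independence of the representative of a coset `P(R) δ` -/

theorem adelicCoord_toAdelic (γ : GL (Fin r) F) (g : GL (Fin r) 𝔸[F]) (x : Fin r → F) :
    adelicCoord (toAdelic F F r γ * g) ((γ : Matrix (Fin r) (Fin r) F).mulVec x) =
      adelicCoord g x := by
  have h1 : (fun j => algebraMap F 𝔸[F] ((γ : Matrix (Fin r) (Fin r) F).mulVec x j)) =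
      (toAdelic F F r γ : Matrix (Fin r) (Fin r) 𝔸[F]).mulVec
        (fun j => algebraMap F 𝔸[F] (x j)) := by
    ext i : 1
    simp only [Matrix.mulVec, dotProduct, map_sum, map_mul]
    rfl
  change ((toAdelic F F r γ * g)⁻¹ : GL (Fin r) 𝔸[F]).1.mulVec
      (fun j => algebraMap F 𝔸[F] ((γ : Matrix (Fin r) (Fin r) F).mulVec x j)) =
    (g⁻¹ : GL (Fin r) 𝔸[F]).1.mulVec (fun j => algebraMap F 𝔸[F] (x j))
  rw [h1, Matrix.mulVec_mulVec, ← Units.val_mul, mul_inv_rev, mul_assoc, inv_mul_cancel, mul_one]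

theorem lattice_toAdelic_le {c : Composition r} {γ : GL (Fin r) F} (hγ : γ ∈ stdParabolic F c)
    (g : GL (Fin r) 𝔸[F]) (k : ℕ) :
    lattice g (coordSpace F r (c.sizeUpTo k)) ≤
      lattice (toAdelic F F r γ * g) (coordSpace F r (c.sizeUpTo k)) := by
  rintro _ ⟨x, ⟨hx, hxW⟩, rfl⟩
  refine ⟨(γ : Matrix (Fin r) (Fin r) F).mulVec x,
    ⟨fun v i => ?_, coordSpace_of_blockTriangular hγ hxW⟩, ?_⟩
  · rw [adelicCoord_toAdelic]
    exact hx v i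
  · change archEmbedding _ _ = archEmbedding _ _
    ext a
    change NumberField.InfinitePlace.Completion.extensionEmbedding a.1 _ =
      NumberField.InfinitePlace.Completion.extensionEmbedding a.1 _
    rw [adelicCoord_toAdelic]

theorem lattice_toAdelic {c : Composition r} {γ : GL (Fin r) F} (hγ : γ ∈ stdParabolic F c)
    (g : GL (Fin r) 𝔸[F]) (k : ℕ) :
    lattice (toAdelic F F r γ * g) (coordSpace F r (c.sizeUpTo k)) =
      lattice g (coordSpace F r (c.sizeUpTo k)) := by
  refine le_antisymm ?_ (lattice_toAdelic_le hγ g k)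
  have h := lattice_toAdelic_le (inv_mem hγ) (toAdelic F F r γ * g) k
  rwa [← mul_assoc, ← map_mul, inv_mul_cancel, map_one, one_mul] at h

theorem vertex_toAdelic {c : Composition r} {γ : GL (Fin r) F} (hγ : γ ∈ stdParabolic F c)
    (g : GL (Fin r) 𝔸[F]) (k : ℕ) :
    vertex (toAdelic F F r γ * g) (coordSpace F r (c.sizeUpTo k)) =
      vertex g (coordSpace F r (c.sizeUpTo k)) := by
  have htop : (⊤ : Submodule F (Fin r → F)) = coordSpace F r (c.sizeUpTo c.length) :=
    (stdFiltration F c).space_last.symm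
  simp only [vertex, subDegree, htop, lattice_toAdelic hγ]

theorem polygon_toAdelic {c : Composition r} {γ : GL (Fin r) F} (hγ : γ ∈ stdParabolic F c)
    (g : GL (Fin r) 𝔸[F]) :
    polygon (toAdelic F F r γ * g) (stdFiltration F c) = polygon g (stdFiltration F c) := by
  ext x
  simp only [polygon, stdFiltration, vertex_toAdelic hγ]

theorem polygon_eq_of_rightRel (R : Type*) [CommRing R] [Algebra R F] (g : GL (Fin r) 𝔸[F])
    (c : Composition r) {δ δ' : GL (Fin r) R}
    (h : (QuotientGroup.rightRel (stdParabolic R c)).r δ δ') :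
    polygon (toAdelic R F r δ * g) (stdFiltration F c) =
      polygon (toAdelic R F r δ' * g) (stdFiltration F c) := by
  have h1 : δ' * δ⁻¹ ∈ stdParabolic R c := QuotientGroup.rightRel_apply.1 h
  have h2 : Matrix.GeneralLinearGroup.map (algebraMap R F) (δ' * δ⁻¹) ∈ stdParabolic F c := by
    intro i j hij
    have h3 : ((δ' * δ⁻¹ : GL (Fin r) R) : Matrix (Fin r) (Fin r) R) i j = 0 := h1 hij
    change algebraMap R F _ = 0
    rw [h3, map_zero]
  have h4 : toAdelic F F r (Matrix.GeneralLinearGroup.map (algebraMap R F) (δ' * δ⁻¹)) =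
      toAdelic R F r (δ' * δ⁻¹) := by
    ext i j : 2
    rfl
  have h5 := polygon_toAdelic h2 (toAdelic R F r δ * g)
  rw [h4, ← mul_assoc, ← map_mul, inv_mul_cancel_right] at h5
  exact h5.symm

/-- The coset space `P(R) \ GL_r(R)`, for the standard parabolic subgroup `P` of the partition
`c`. -/
abbrev Cosets (R : Type*) [CommRing R] {r : ℕ} (c : Composition r) : Type _ :=
  Quotient (QuotientGroup.rightRel (stdParabolic R c))

/-- The polygon `p_P^{δg}` as a function of the coset `P(R) δ`. -/
def cosetPolygon (R : Type*) [CommRing R] [Algebra R F] (g : GL (Fin r) 𝔸[F])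
    (c : Composition r) : Cosets R c → ℝ → ℝ :=
  Quotient.lift (fun δ => polygon (toAdelic R F r δ * g) (stdFiltration F c))
    fun _ _ h => polygon_eq_of_rightRel R g c h

end Lattice

open Classical in
/-- The indicator `𝟏(A)` of a statement. -/
def ind (A : Prop) : ℤ := if A then 1 else 0

end LatticeTruncation

end

noncomputable section

set_option linter.unusedSectionVars false

namespace LatticeTruncation

open IsDedekindDomain Module

/-! ### Lattices in Euclidean spaces -/

section Euclidean

variable {E : Type*} [NormedAddCommGroup E] [InnerProductSpace ℝ E]

/-! Write `v W` for `vertex g W`, the normalized degree of `Λ^g_W`. Everything rests on two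
properties of `v`. It is supermodular, `v A + v B ≤ v (A ⊓ B) + v (A ⊔ B)` (`vertex_add_vertex_le`,
from `covol_sup_mul_covol_inf_le`), and only finitely many subspaces satisfy `C ≤ v W`
(`finite_setOf_le_vertex`, from `finite_sublattices_covol_le`). Finiteness yields the
Harder–Narasimhan filtration and supermodularity its uniqueness. Supermodularity also shows that the
canonical polygon is the concave hull of the points `(dim W, v W)`. Since `p` is concave, the
canonical polygon is at most `p` exactly when the set `S` of all `W` with `v W > p (dim W)` is empty
(`canonicalPolygon_le_iff`).

On the other side, `δ ↦ (δ⁻¹ F ^ rᵢ)ᵢ` identifies `P(F) \ G(F)` with the flags whose dimensions are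
the `rᵢ`, and the condition on `p_P^{δg}` says that the proper nonzero members of the flag lie in
`S` (`bijOn_flagSet`). Subspaces in `S` are proper and nonzero, and the dimensions in a chain
determine `P`, so the right hand side is the sum of `(-1) ^ |T|` over all chains `T` in `S`, the
empty one included: minus the reduced Euler characteristic of the poset `S`.

If `S` is empty, the sum is 1. Otherwise take `A` in `S` with the largest excess `v A - p (dim A)`.
Supermodularity of `v` and concavity of `p` show that `A ⊓ B` lies in `S` for every `B` in `S`.
Hence `B ≥ A ⊓ B ≤ A` contracts `S` conically and the sum is 0 (`sum_chains_eq_zero`).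

The flags are also parametrized by `P(R) \ GL_r(R)` for any principal ideal domain `R` with fraction
field `F`, because each flag has an adapted basis of `R ^ r` (`exists_matrix_map_coordSpace`). The
cases `R = F` and `R = ℤ` give the two assertions. -/

theorem gram_eq_of_combination {ι : Type*} [Fintype ι] {κ : Type*} (w : ι → E) (T : Matrix ι κ ℝ) :
    Matrix.gram ℝ (fun j => ∑ i, T i j • w i) = T.transpose * Matrix.gram ℝ w * T := by
  ext i j
  simp only [Matrix.gram_apply, Matrix.mul_apply, Matrix.transpose_apply, sum_inner, inner_sum,
    inner_smul_left, inner_smul_right, Finset.sum_mul]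
  refine Finset.sum_congr rfl fun a _ => ?_
  rw [Finset.mul_sum]
  refine Finset.sum_congr rfl fun b _ => ?_
  rw [conj_trivial, real_inner_comm]
  ring

variable [FiniteDimensional ℝ E]

theorem discreteTopology_span {ι : Type*} [Finite ι] {v : ι → E} (hv : LinearIndependent ℝ v) :
    DiscreteTopology (Submodule.span ℤ (Set.range v)) := by
  have h : Submodule.span ℤ (Set.range v) ≤
      Submodule.span ℤ (Set.range (Basis.extend hv.linearIndepOn_id)) := by
    refine Submodule.span_mono ?_
    rw [Basis.range_extend]
    exact hv.linearIndepOn_id.subset_extend _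
  have : Finite (hv.linearIndepOn_id.extend (Set.subset_univ _)) :=
    Module.Finite.finite_basis (Basis.extend hv.linearIndepOn_id)
  have h2 : DiscreteTopology
      (Submodule.span ℤ (Set.range (Basis.extend hv.linearIndepOn_id))) := inferInstance
  exact DiscreteTopology.of_subset h2 h

instance discreteTopology_comap_span (L : Submodule ℤ E) [DiscreteTopology L] :
    DiscreteTopology
      (L.comap ((Submodule.span ℝ (L : Set E)).subtype.restrictScalars ℤ)) :=
  DiscreteTopology.preimage_of_continuous_injective (L : Set E) continuous_subtype_val
    Subtype.val_injective

instance isZLattice_comap_span (L : Submodule ℤ E) [DiscreteTopology L] :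
    IsZLattice ℝ (L.comap ((Submodule.span ℝ (L : Set E)).subtype.restrictScalars ℤ)) :=
  ⟨eq_top_iff.mpr (Submodule.span_span_coe_preimage (R := ℝ) (s := (L : Set E))).ge⟩

/-- A lattice is isomorphic to itself, viewed in its real span. -/
def equivComapSpan (L : Submodule ℤ E) :
    L.comap ((Submodule.span ℝ (L : Set E)).subtype.restrictScalars ℤ) ≃ₗ[ℤ] L :=
  Submodule.comapSubtypeEquivOfLe (p := L)
    (q := (Submodule.span ℝ (L : Set E)).restrictScalars ℤ) Submodule.subset_span

/-- Discreteness is essential: inside its real span `L` is a full lattice, so a `ℤ`-basis of it is a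
real basis of the span. -/
theorem linearIndependent_real_of_basis (L : Submodule ℤ E) [DiscreteTopology L] {ι : Type*}
    (b : Basis ι ℤ L) : LinearIndependent ℝ fun i => (b i : E) := by
  have h := ((b.map (equivComapSpan L).symm).ofZLatticeBasis ℝ _).linearIndependent
  have h2 := h.map' (Submodule.span ℝ (L : Set E)).subtype (Submodule.ker_subtype _)
  have h3 : (fun i => (b i : E)) = (Submodule.span ℝ (L : Set E)).subtype ∘
      (b.map (equivComapSpan L).symm).ofZLatticeBasis ℝ _ := by
    ext i
    rw [Function.comp_apply, Basis.ofZLatticeBasis_apply]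
    rfl
  rw [h3]
  exact h2

theorem exists_lattice_basis (L : Submodule ℤ E) [DiscreteTopology L] :
    ∃ (n : ℕ) (v : Fin n → E), LinearIndependent ℝ v ∧ L = Submodule.span ℤ (Set.range v) := by
  let b := Module.finBasis ℤ L
  refine ⟨_, fun i => (b i : E), linearIndependent_real_of_basis L b, ?_⟩
  have h := congrArg (Submodule.map L.subtype) b.span_eq
  rw [Submodule.map_span, ← Set.range_comp, Submodule.map_top, Submodule.range_subtype] at h
  exact h.symm

section covol

variable [MeasurableSpace E] [BorelSpace E]

/-- The covolume of a lattice in its own real span. -/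
def covol (L : Submodule ℤ E) : ℝ :=
  ZLattice.covolume
    (L.comap ((Submodule.span ℝ (L : Set E)).subtype.restrictScalars ℤ)) MeasureTheory.volume

theorem covol_pos (L : Submodule ℤ E) [DiscreteTopology L] : 0 < covol L :=
  ZLattice.covolume_pos _ _

/-- If `M` is the coordinate matrix of the basis in an orthonormal basis of the span, then the
covolume is `|det M|` and the Gram matrix is `Mᵀ M`. -/
theorem covol_sq_of_basis (L : Submodule ℤ E) [DiscreteTopology L] {ι : Type*} [Fintype ι]
    [DecidableEq ι] (b : Basis ι ℤ L) :
    covol L ^ 2 = (Matrix.gram ℝ fun i => (b i : E)).det := by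
  set b' := b.map (equivComapSpan L).symm with hb'
  have hcard : Fintype.card (Fin (finrank ℝ (Submodule.span ℝ (L : Set E)))) = Fintype.card ι := by
    rw [Fintype.card_fin, Module.finrank_eq_card_basis (b'.ofZLatticeBasis ℝ _)]
  let b₀ := (stdOrthonormalBasis ℝ (Submodule.span ℝ (L : Set E))).reindex
    (Fintype.equivOfCardEq hcard)
  have h1 := ZLattice.covolume_eq_det_mul_measureReal _ MeasureTheory.volume b' b₀.toBasis
  have h2 : MeasureTheory.volume.real (ZSpan.fundamentalDomain b₀.toBasis) = 1 := by
    rw [MeasureTheory.measureReal_congr (ZSpan.fundamentalDomain_ae_parallelepiped _ _),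
      OrthonormalBasis.coe_toBasis, MeasureTheory.measureReal_def,
      OrthonormalBasis.volume_parallelepiped, ENNReal.toReal_one]
  have h3 : (Matrix.gram ℝ fun i => (b i : E)) =
      Matrix.gram ℝ fun i => (b' i : Submodule.span ℝ (L : Set E)) := by
    ext i j
    rfl
  rw [covol, h1, h2, mul_one, sq_abs, h3, Matrix.gram_eq_conjTranspose_mul b₀, Matrix.det_mul,
    Matrix.det_conjTranspose, star_trivial, ← sq]
  rfl

theorem covol_span_sq {ι : Type*} [Fintype ι] [DecidableEq ι] {v : ι → E}
    (hv : LinearIndependent ℝ v) :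
    covol (Submodule.span ℤ (Set.range v)) ^ 2 = (Matrix.gram ℝ v).det := by
  have := discreteTopology_span hv
  have hvZ : LinearIndependent ℤ v := hv.restrict_scalars (by
    intro a b hab
    simpa using hab)
  rw [covol_sq_of_basis _ (Basis.span hvZ)]
  congr 2
  ext i
  rw [Basis.span_apply]

theorem covol_bot : covol (⊥ : Submodule ℤ E) = 1 := by
  have h := covol_span_sq (E := E) (v := (Fin.elim0 : Fin 0 → E)) (linearIndependent_empty_type)
  rw [Set.range_eq_empty, Submodule.span_empty, Matrix.det_isEmpty] at h
  have : DiscreteTopology (⊥ : Submodule ℤ E) := inferInstance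
  have h2 := covol_pos (⊥ : Submodule ℤ E)
  nlinarith

end covol

/-- Subtracting from each `w j` its component in the span of `v` is a unipotent change of vectors,
and it makes the Gram matrix block diagonal. -/
theorem det_gram_sumElim {ι κ : Type*} [Fintype ι] [DecidableEq ι] [Fintype κ] [DecidableEq κ]
    (v : ι → E) (w : κ → E) :
    (Matrix.gram ℝ (Sum.elim v w)).det = (Matrix.gram ℝ v).det *
      (Matrix.gram ℝ fun j => (Submodule.span ℝ (Set.range v))ᗮ.starProjection (w j)).det := by
  set U := Submodule.span ℝ (Set.range v)
  have h : ∀ j, ∃ c : ι → ℝ, ∑ i, c i • v i = U.starProjection (w j) := fun j =>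
    (Submodule.mem_span_range_iff_exists_fun ℝ).1 (Submodule.starProjection_apply_mem _ _)
  choose c hc using h
  let T : Matrix (ι ⊕ κ) (ι ⊕ κ) ℝ := Matrix.fromBlocks 1 (Matrix.of fun i j => c j i) 0 1
  have h1 : Sum.elim v w = fun j => ∑ i, T i j • Sum.elim v (fun j => Uᗮ.starProjection (w j)) i := by
    ext j
    rw [Fintype.sum_sum_type]
    rcases j with j | j
    · simp [T, Matrix.one_apply, ite_smul]
    · simp [T, Matrix.one_apply, ite_smul, hc]
  have h2 : Matrix.gram ℝ (Sum.elim v fun j => Uᗮ.starProjection (w j)) =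
      Matrix.fromBlocks (Matrix.gram ℝ v) 0 0
        (Matrix.gram ℝ fun j => Uᗮ.starProjection (w j)) := by
    have h0 : ∀ i j, inner ℝ (v i) (Uᗮ.starProjection (w j)) = 0 := fun i j =>
      (Submodule.mem_orthogonal U _).1 (Submodule.starProjection_apply_mem _ _) _
        (Submodule.subset_span ⟨i, rfl⟩)
    ext i j
    rcases i with i | i <;> rcases j with j | j <;> simp only [Matrix.gram_apply, Sum.elim_inl, Sum.elim_inr, Matrix.fromBlocks_apply₁₁,
      Matrix.fromBlocks_apply₁₂, Matrix.fromBlocks_apply₂₁, Matrix.fromBlocks_apply₂₂, Matrix.zero_apply]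
    · exact h0 i j
    · rw [real_inner_comm]
      exact h0 j i
  rw [h1, gram_eq_of_combination, Matrix.det_mul, Matrix.det_mul, Matrix.det_transpose, h2,
    Matrix.det_fromBlocks_zero₂₁, Matrix.det_fromBlocks_zero₂₁]
  simp

end Euclidean

/-! ### Primitive sublattices, quotients and submodularity of covolumes -/

section EuclideanLattices

variable {E : Type*} [NormedAddCommGroup E] [InnerProductSpace ℝ E] [FiniteDimensional ℝ E]

theorem discreteTopology_of_le {L L' : Submodule ℤ E} [hd : DiscreteTopology L'] (h : L ≤ L') :
    DiscreteTopology L :=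
  DiscreteTopology.of_subset hd h

theorem span_real_span_int (s : Set E) :
    Submodule.span ℝ (Submodule.span ℤ s : Set E) = Submodule.span ℝ s :=
  Submodule.span_span_of_tower ℤ ℝ s

theorem linearIndependent_real_of_int {L : Submodule ℤ E} [DiscreteTopology L] {ι : Type*}
    {v : ι → E} (hv : LinearIndependent ℤ v) (hL : ∀ i, v i ∈ L) : LinearIndependent ℝ v := by
  have hle : Submodule.span ℤ (Set.range v) ≤ L := by
    rw [Submodule.span_le]
    rintro _ ⟨i, rfl⟩
    exact hL i
  have := discreteTopology_of_le hle
  have h := linearIndependent_real_of_basis _ (Basis.span hv)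
  simpa only [Basis.span_apply] using h

theorem linearIndependent_int_of_real {ι : Type*} {v : ι → E} (hv : LinearIndependent ℝ v) :
    LinearIndependent ℤ v :=
  hv.restrict_scalars fun a b hab => by simpa using hab

theorem starProjection_orthogonal_eq_zero {V : Submodule ℝ E} {x : E} (hx : x ∈ V) :
    Vᗮ.starProjection x = 0 := by
  refine (Submodule.starProjection_apply_eq_zero_iff _).2 ?_
  rwa [Submodule.orthogonal_orthogonal]

/-- A basis of a primitive sublattice extends to a basis of the lattice. -/
theorem exists_extended_basis {L L' : Submodule ℤ E} [DiscreteTopology L'] (hle : L ≤ L')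
    (hprim : ∀ x ∈ L', x ∈ Submodule.span ℝ (L : Set E) → x ∈ L) :
    ∃ (m n : ℕ) (v : Fin m → E) (w : Fin n → E), LinearIndependent ℝ (Sum.elim v w) ∧
      L = Submodule.span ℤ (Set.range v) ∧ L' = Submodule.span ℤ (Set.range (Sum.elim v w)) := by
  have hdL := discreteTopology_of_le hle
  -- By primitivity the kernel of this projection is `L`. The quotient embeds into `E`, so it is
  -- torsion free, hence free, and the extension splits.
  let f : L' →ₗ[ℤ] E :=
    ((Submodule.span ℝ (L : Set E))ᗮ.starProjection.toLinearMap.restrictScalars ℤ).comp L'.subtype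
  have hker : ∀ x : L', x ∈ LinearMap.ker f ↔ (x : E) ∈ L := by
    intro x
    have h1 : f x = 0 ↔ (x : E) ∈ (Submodule.span ℝ (L : Set E))ᗮᗮ :=
      Submodule.starProjection_apply_eq_zero_iff _
    rw [LinearMap.mem_ker, h1, Submodule.orthogonal_orthogonal]
    exact ⟨hprim x x.2, fun h => Submodule.subset_span h⟩
  have hmap : (LinearMap.ker f).map L'.subtype = L := by
    ext x
    constructor
    · rintro ⟨y, hy, rfl⟩
      exact (hker y).1 hy
    · intro hx
      exact ⟨⟨x, hle hx⟩, (hker _).2 hx, rfl⟩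
  have : Module ℚ E := Module.compHom E (algebraMap ℚ ℝ)
  have : IsAddTorsionFree E := .of_module_rat _
  have : Module.Finite ℤ (L' ⧸ LinearMap.ker f) := inferInstance
  have : Module.Free ℤ (LinearMap.range f) :=
    inferInstance
  have : Module.Free ℤ (L' ⧸ LinearMap.ker f) := Module.Free.of_equiv f.quotKerEquivRange.symm
  let bW := Module.finBasis ℤ (LinearMap.ker f)
  let bQ := Module.finBasis ℤ (L' ⧸ LinearMap.ker f)
  let b := Basis.sumQuot bW bQ
  have hb : (fun i => (b i : E)) =
      Sum.elim (fun i => ((bW i : L') : E)) (fun j => (b (Sum.inr j) : E)) := by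
    ext i
    rcases i with i | i
    · exact congrArg Subtype.val (Basis.sumQuot_inl bW bQ i)
    · rfl
  refine ⟨_, _, fun i => ((bW i : L') : E), fun j => (b (Sum.inr j) : E), ?_, ?_, ?_⟩
  · rw [← hb]
    exact linearIndependent_real_of_basis L' b
  · have h := congrArg (Submodule.map (L'.subtype.comp (LinearMap.ker f).subtype)) bW.span_eq
    rw [Submodule.map_span, ← Set.range_comp, Submodule.map_top, LinearMap.range_comp,
      Submodule.range_subtype, hmap] at h
    exact h.symm
  · have h := congrArg (Submodule.map L'.subtype) b.span_eq
    rw [Submodule.map_span, ← Set.range_comp, Submodule.map_top, Submodule.range_subtype] at h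
    rw [← hb]
    exact h.symm

/-- The image of a lattice under the orthogonal projection along the span of a sublattice. -/
def projLattice (L L' : Submodule ℤ E) : Submodule ℤ E :=
  L'.map ((Submodule.span ℝ (L : Set E))ᗮ.starProjection.toLinearMap.restrictScalars ℤ)

theorem det_gram_pos {ι : Type*} [Fintype ι] [DecidableEq ι] {v : ι → E}
    (hv : LinearIndependent ℝ v) : 0 < (Matrix.gram ℝ v).det :=
  (Matrix.posDef_gram_of_linearIndependent hv).det_pos

theorem linearIndependent_proj {ι κ : Type*} [Fintype ι] [DecidableEq ι] [Fintype κ]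
    [DecidableEq κ] {v : ι → E} {w : κ → E} (h : LinearIndependent ℝ (Sum.elim v w)) :
    LinearIndependent ℝ fun j => (Submodule.span ℝ (Set.range v))ᗮ.starProjection (w j) := by
  refine Matrix.linearIndependent_of_det_gram_ne_zero (𝕜 := ℝ) fun h0 => ?_
  have h1 := det_gram_sumElim v w
  rw [h0, mul_zero] at h1
  exact (det_gram_pos h).ne' h1

theorem projLattice_span {ι κ : Type*} (v : ι → E) (w : κ → E) :
    projLattice (Submodule.span ℤ (Set.range v)) (Submodule.span ℤ (Set.range (Sum.elim v w))) =
      Submodule.span ℤ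
        (Set.range fun j => (Submodule.span ℝ (Set.range v))ᗮ.starProjection (w j)) := by
  -- The real span of the lattice becomes a variable, so that it can be replaced inside the
  -- projection.
  suffices h : ∀ V : Submodule ℝ E, V = Submodule.span ℝ (Set.range v) →
      (Submodule.span ℤ (Set.range (Sum.elim v w))).map
        (Vᗮ.starProjection.toLinearMap.restrictScalars ℤ) = Submodule.span ℤ
        (Set.range fun j => (Submodule.span ℝ (Set.range v))ᗮ.starProjection (w j)) from
    h _ (span_real_span_int _)
  rintro _ rfl
  rw [Submodule.map_span, Set.Sum.elim_range, Set.image_union,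
    Submodule.span_union]
  have h0 : Submodule.span ℤ ((((Submodule.span ℝ
      (Set.range v))ᗮ.starProjection.toLinearMap.restrictScalars ℤ) : E → E) '' Set.range v) = ⊥ := by
    rw [Submodule.span_eq_bot]
    rintro _ ⟨_, ⟨i, rfl⟩, rfl⟩
    rw [LinearMap.restrictScalars_apply, ContinuousLinearMap.coe_coe]
    exact starProjection_orthogonal_eq_zero (Submodule.subset_span ⟨i, rfl⟩)
  rw [h0, bot_sup_eq, ← Set.range_comp]
  rfl

theorem discreteTopology_projLattice {L L' : Submodule ℤ E} [DiscreteTopology L'] (hle : L ≤ L')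
    (hprim : ∀ x ∈ L', x ∈ Submodule.span ℝ (L : Set E) → x ∈ L) :
    DiscreteTopology (projLattice L L') := by
  obtain ⟨m, n, v, w, h, rfl, rfl⟩ := exists_extended_basis hle hprim
  rw [projLattice_span]
  exact discreteTopology_span (linearIndependent_proj h)

variable [MeasurableSpace E] [BorelSpace E]

theorem covol_nonneg (L : Submodule ℤ E) : 0 ≤ covol L := ENNReal.toReal_nonneg

theorem covol_eq_mul_projLattice {L L' : Submodule ℤ E} [DiscreteTopology L'] (hle : L ≤ L')
    (hprim : ∀ x ∈ L', x ∈ Submodule.span ℝ (L : Set E) → x ∈ L) :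
    covol L' = covol L * covol (projLattice L L') := by
  obtain ⟨m, n, v, w, h, rfl, rfl⟩ := exists_extended_basis hle hprim
  have hv : LinearIndependent ℝ v := by
    simpa using h.comp Sum.inl Sum.inl_injective
  refine (pow_left_inj₀ (covol_nonneg _) (mul_nonneg (covol_nonneg _) (covol_nonneg _))
    two_ne_zero).1 ?_
  rw [mul_pow, projLattice_span, covol_span_sq h, covol_span_sq hv,
    covol_span_sq (linearIndependent_proj h), det_gram_sumElim]

/-- A basis of `L` is an integral combination of a basis of `L'`, with nonzero determinant; its
square is at least 1. -/
theorem covol_le_of_le {L L' : Submodule ℤ E} [DiscreteTopology L'] (hle : L ≤ L')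
    (hspan : Submodule.span ℝ (L : Set E) = Submodule.span ℝ (L' : Set E)) :
    covol L' ≤ covol L := by
  have := discreteTopology_of_le hle
  obtain ⟨m, v, hv, rfl⟩ := exists_lattice_basis L
  obtain ⟨n, w, hw, rfl⟩ := exists_lattice_basis L'
  rw [span_real_span_int, span_real_span_int] at hspan
  obtain rfl : m = n := by
    have h := congrArg (fun V : Submodule ℝ E => finrank ℝ V) hspan
    simpa [finrank_span_eq_card hv, finrank_span_eq_card hw] using h
  have h : ∀ j, ∃ c : Fin m → ℤ, ∑ i, c i • w i = v j := fun j =>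
    (Submodule.mem_span_range_iff_exists_fun ℤ).1 (hle (Submodule.subset_span ⟨j, rfl⟩))
  choose c hc using h
  let A : Matrix (Fin m) (Fin m) ℤ := Matrix.of fun i j => c j i
  have h1 : v = fun j => ∑ i, A.map (Int.castRingHom ℝ) i j • w i := by
    ext j
    simp [A, ← hc, Int.cast_smul_eq_zsmul]
  have h2 : (Matrix.gram ℝ v).det = ((A.det : ℤ) : ℝ) ^ 2 * (Matrix.gram ℝ w).det := by
    rw [h1, gram_eq_of_combination, Matrix.det_mul, Matrix.det_mul, Matrix.det_transpose,
      ← RingHom.mapMatrix_apply, ← RingHom.map_det]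
    simp only [eq_intCast]
    ring
  have hv0 := det_gram_pos hv
  have hw0 := det_gram_pos hw
  have h3 : A.det ≠ 0 := by
    rintro h3
    rw [h2, h3] at hv0
    simp at hv0
  have h4 : (1 : ℝ) ≤ ((A.det : ℤ) : ℝ) ^ 2 := by
    have : (1 : ℤ) ≤ A.det ^ 2 := by
      have := sq_pos_of_ne_zero h3
      omega
    exact_mod_cast this
  refine (pow_le_pow_iff_left₀ (covol_nonneg _) (covol_nonneg _) two_ne_zero).1 ?_
  rw [covol_span_sq hv, covol_span_sq hw, h2]
  nlinarith

open scoped MatrixOrder Matrix.Norms.L2Operator in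
-- Writing `A = C* C` gives `A + B = C* (1 + D) C` with `D` positive semidefinite, and all
-- eigenvalues of `1 + D` are at least 1.
theorem det_le_det_add_posSemidef {ι : Type*} [Fintype ι] [DecidableEq ι] {A B : Matrix ι ι ℝ}
    (hA : A.PosDef) (hB : B.PosSemidef) : A.det ≤ (A + B).det := by
  obtain ⟨C, rfl⟩ := CStarAlgebra.nonneg_iff_eq_star_mul_self.mp hA.posSemidef.nonneg
  have hdet : 0 < C.det ^ 2 := by
    have h := hA.det_pos
    rwa [Matrix.star_eq_conjTranspose, Matrix.det_mul, Matrix.det_conjTranspose, star_trivial,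
      ← sq] at h
  have hC : IsUnit C.det := isUnit_iff_ne_zero.2 fun h => by simp [h] at hdet
  set D := (C⁻¹).conjTranspose * B * C⁻¹
  have hD : D.PosSemidef := hB.conjTranspose_mul_mul_same _
  have h1 : star C * C + B = C.conjTranspose * (1 + D) * C := by
    have h2 : C.conjTranspose * D * C =
        (C⁻¹ * C).conjTranspose * B * (C⁻¹ * C) := by
      rw [Matrix.conjTranspose_mul]
      simp only [D, Matrix.mul_assoc]
    rw [Matrix.nonsing_inv_mul _ hC, Matrix.conjTranspose_one, one_mul, mul_one] at h2
    rw [mul_add, add_mul, h2, mul_one, Matrix.star_eq_conjTranspose]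
  have h3 : (1 : ℝ) ≤ (1 + D).det := by
    have hH : (1 + D).IsHermitian := Matrix.isHermitian_one.add hD.isHermitian
    rw [hH.det_eq_prod_eigenvalues]
    refine Finset.one_le_prod fun i => ?_
    have hn : star ⇑(hH.eigenvectorBasis i) ⬝ᵥ ⇑(hH.eigenvectorBasis i) = (1 : ℝ) := by
      have := hH.eigenvectorBasis.orthonormal.1 i
      rw [dotProduct_comm, ← EuclideanSpace.inner_eq_star_dotProduct,
        real_inner_self_eq_norm_sq, this, one_pow]
    have h4 := hD.dotProduct_mulVec_nonneg ⇑(hH.eigenvectorBasis i)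
    rw [hH.eigenvalues_eq, Matrix.add_mulVec, Matrix.one_mulVec, dotProduct_add, hn]
    simpa using h4
  rw [h1, Matrix.star_eq_conjTranspose, Matrix.det_mul, Matrix.det_mul, Matrix.det_mul,
    Matrix.det_conjTranspose, star_trivial]
  nlinarith

/-- A contraction decreases the Gram matrix in the positive semidefinite order, hence its
determinant. -/
theorem det_gram_comp_le {ι : Type*} [Fintype ι] [DecidableEq ι] (f : E →L[ℝ] E) (hf : ‖f‖ ≤ 1)
    {v : ι → E} (hv : LinearIndependent ℝ (f ∘ v)) :
    (Matrix.gram ℝ (f ∘ v)).det ≤ (Matrix.gram ℝ v).det := by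
  have h1 := Matrix.posSemidef_opNorm_smul_gram_sub_gram v f
  have h2 : (Matrix.gram ℝ v - Matrix.gram ℝ (f ∘ v)).PosSemidef := by
    have h3 : (((1 : ℝ) - ‖f‖ ^ 2) • Matrix.gram ℝ v).PosSemidef :=
      (Matrix.posSemidef_gram ℝ v).smul (by nlinarith [norm_nonneg f])
    have := h3.add h1
    rwa [sub_smul, one_smul, sub_add_sub_cancel] at this
  have := det_le_det_add_posSemidef (Matrix.posDef_gram_of_linearIndependent hv) h2
  rwa [add_sub_cancel] at this

/-- The covolumes of lattices are submodular. -/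
theorem covol_sup_mul_covol_inf_le {A B S Λ : Submodule ℤ E} [DiscreteTopology Λ]
    (hA : A ≤ S) (hB : B ≤ S) (hS : S ≤ Λ)
    (hspan : (S : Set E) ⊆ Submodule.span ℝ ((A ⊔ B : Submodule ℤ E) : Set E))
    (hprim : ∀ x ∈ B, x ∈ Submodule.span ℝ ((A ⊓ B : Submodule ℤ E) : Set E) → x ∈ A) :
    covol S * covol (A ⊓ B) ≤ covol A * covol B := by
  have dS := discreteTopology_of_le hS
  have dA := discreteTopology_of_le hA
  have dB := discreteTopology_of_le hB
  -- `S` may be strictly larger than `A ⊔ B`, but it has the same real span, so its covolume is no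
  -- larger.
  have hS' : covol S ≤ covol (A ⊔ B) := by
    refine covol_le_of_le (sup_le hA hB) (le_antisymm (Submodule.span_mono (sup_le hA hB)) ?_)
    rwa [Submodule.span_le]
  refine (mul_le_mul_of_nonneg_right hS' (covol_nonneg _)).trans ?_
  obtain ⟨a, u, hu, hAu⟩ := exists_lattice_basis A
  -- Here `u` is a basis of `A`, `v` of `A ⊓ B` and `(v, w)` of `B`; it follows that `(u, w)` is a
  -- basis of `A ⊔ B`.
  obtain ⟨m, n, v, w, hvw, hI, hB'⟩ := exists_extended_basis (L := A ⊓ B) (L' := B) inf_le_right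
    fun x hx hx' => ⟨hprim x hx hx', hx⟩
  have hsup : A ⊔ B = Submodule.span ℤ (Set.range (Sum.elim u w)) := by
    rw [Set.Sum.elim_range, Submodule.span_union, ← hAu]
    have h1 : B = (A ⊓ B) ⊔ Submodule.span ℤ (Set.range w) := by
      rw [hI, ← Submodule.span_union, ← Set.Sum.elim_range, ← hB']
    refine le_antisymm (sup_le le_sup_left ?_) (sup_le le_sup_left ?_)
    · rw [h1]
      exact sup_le_sup_right inf_le_left _
    · refine le_trans ?_ le_sup_right
      conv_rhs => rw [h1]
      exact le_sup_right
  have hw' : Submodule.span ℤ (Set.range w) ≤ B := by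
    rw [hB', Set.Sum.elim_range, Submodule.span_union]
    exact le_sup_right
  have huwZ : LinearIndependent ℤ (Sum.elim u w) := by
    have h1 := linearIndependent_sum.1 (linearIndependent_int_of_real hvw)
    refine (linearIndependent_int_of_real hu).sum_type (by simpa using h1.2.1) ?_
    rw [Submodule.disjoint_def]
    intro x hx hx'
    have h2 := h1.2.2
    simp only [Sum.elim_comp_inl, Sum.elim_comp_inr] at h2
    rw [Submodule.disjoint_def] at h2
    refine h2 x ?_ hx'
    rw [← hI]
    exact ⟨hAu ▸ hx, hw' hx'⟩
  have huw : LinearIndependent ℝ (Sum.elim u w) := by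
    have := discreteTopology_of_le (sup_le hA hB)
    refine linearIndependent_real_of_int (L := A ⊔ B) huwZ fun i => ?_
    rw [hsup]
    exact Submodule.subset_span ⟨i, rfl⟩
  have hv : LinearIndependent ℝ v := by
    simpa using hvw.comp Sum.inl Sum.inl_injective
  have hle : Submodule.span ℝ (Set.range v) ≤ Submodule.span ℝ (Set.range u) := by
    rw [← span_real_span_int, ← span_real_span_int (Set.range u), ← hI, ← hAu]
    exact Submodule.span_mono inf_le_left
  -- After cancellation of the factors from `u` and `v`, the projections of `w` orthogonal to `u`
  -- and to `v` remain. As the span of `v` lies in that of `u`, the former arise from the latter by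
  -- a contraction.
  have hcomp : (fun j => (Submodule.span ℝ (Set.range u))ᗮ.starProjection (w j)) =
      (Submodule.span ℝ (Set.range u))ᗮ.starProjection ∘
        fun j => (Submodule.span ℝ (Set.range v))ᗮ.starProjection (w j) := by
    ext1 j
    have h0 : (Submodule.span ℝ (Set.range u))ᗮ.starProjection
        ((Submodule.span ℝ (Set.range v)).starProjection (w j)) = 0 := by
      refine (Submodule.starProjection_apply_eq_zero_iff _).2 ?_
      rw [Submodule.orthogonal_orthogonal]
      exact hle (Submodule.starProjection_apply_mem _ _)
    rw [Function.comp_apply,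
      (Submodule.span ℝ (Set.range v)).starProjection_orthogonal_val (w j), map_sub, h0, sub_zero]
  have hdet := det_gram_comp_le ((Submodule.span ℝ (Set.range u))ᗮ.starProjection)
    (Submodule.starProjection_norm_le _) (hcomp ▸ linearIndependent_proj huw)
  rw [← hcomp] at hdet
  refine (pow_le_pow_iff_left₀ (mul_nonneg (covol_nonneg _) (covol_nonneg _))
    (mul_nonneg (covol_nonneg _) (covol_nonneg _)) two_ne_zero).1 ?_
  rw [mul_pow, mul_pow, hsup, hI, hAu, hB', covol_span_sq huw, covol_span_sq hv, covol_span_sq hu,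
    covol_span_sq hvw, det_gram_sumElim, det_gram_sumElim v w]
  have h1 := det_gram_pos hu
  have h2 := det_gram_pos hv
  calc _ = ((Matrix.gram ℝ u).det * (Matrix.gram ℝ v).det) * _ := by ring
    _ ≤ ((Matrix.gram ℝ u).det * (Matrix.gram ℝ v).det) * _ :=
      mul_le_mul_of_nonneg_left hdet (by positivity)
    _ = _ := by ring

end EuclideanLattices

/-! ### Reduction theory: finitely many sublattices of bounded covolume -/

section LatticeReduction

variable {E : Type*} [NormedAddCommGroup E] [InnerProductSpace ℝ E] [FiniteDimensional ℝ E]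

theorem finite_lattice_inter_closedBall (L : Submodule ℤ E) [hd : DiscreteTopology L] (R : ℝ) :
    (Metric.closedBall (0 : E) R ∩ L).Finite := by
  change (Metric.closedBall (0 : E) R ∩ L.toAddSubgroup).Finite
  have : DiscreteTopology L.toAddSubgroup := hd
  exact Metric.finite_isBounded_inter_isClosed DiscreteTopology.isDiscrete
    Metric.isBounded_closedBall inferInstance

theorem discreteTopology_of_finite_inter_closedBall (L : Submodule ℤ E)
    (h : (Metric.closedBall (0 : E) 1 ∩ L).Finite) : DiscreteTopology L := by
  obtain ⟨r, hr, hr'⟩ : ∃ r > 0, ∀ x : L, x ≠ 0 → r ≤ ‖x‖ := by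
    have hfin : ((fun x : E => ‖x‖) '' ((Metric.closedBall (0 : E) 1 ∩ L) \ {0})).Finite :=
      (h.subset Set.sdiff_subset).image _
    rcases ((Metric.closedBall (0 : E) 1 ∩ L) \ {0}).eq_empty_or_nonempty with he | hne
    · refine ⟨1, one_pos, fun x hx => ?_⟩
      by_contra! hlt
      have : (x : E) ∈ ((Metric.closedBall (0 : E) 1 ∩ L) \ {0}) :=
        ⟨⟨by simpa using hlt.le, x.2⟩, by simpa using hx⟩
      rw [he] at this
      exact this
    · obtain ⟨y, hy, hmin⟩ := (h.subset Set.sdiff_subset).exists_minimalFor (fun x : E => ‖x‖)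
        ((Metric.closedBall (0 : E) 1 ∩ L) \ {0}) hne
      have hy1 : ‖y‖ ≤ 1 := by simpa using hy.1.1
      refine ⟨‖y‖, norm_pos_iff.2 (by simpa using hy.2), fun x hx => ?_⟩
      by_contra! hlt
      have hx' : (x : E) ∈ ((Metric.closedBall (0 : E) 1 ∩ L) \ {0}) :=
        ⟨⟨by simpa using hlt.le.trans hy1, x.2⟩, by simpa using hx⟩
      exact absurd (hmin hx' hlt.le) (not_le.2 hlt)
  exact DiscreteTopology.of_forall_le_norm hr hr'

theorem exists_shortest_vector (L : Submodule ℤ E) [DiscreteTopology L] (hL : L ≠ ⊥) :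
    ∃ x ∈ L, x ≠ 0 ∧ ∀ y ∈ L, y ≠ 0 → ‖x‖ ≤ ‖y‖ := by
  obtain ⟨z, hz, hz0⟩ := L.exists_mem_ne_zero_of_ne_bot hL
  have hfin := finite_lattice_inter_closedBall L ‖z‖
  obtain ⟨x, hx, hmin⟩ := (hfin.subset Set.sdiff_subset).exists_minimalFor (fun x : E => ‖x‖)
    ((Metric.closedBall (0 : E) ‖z‖ ∩ L) \ {0}) ⟨z, ⟨by simp, hz⟩, by simpa using hz0⟩
  refine ⟨x, hx.1.2, by simpa using hx.2, fun y hy hy0 => ?_⟩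
  by_contra! hlt
  have hxz : ‖x‖ ≤ ‖z‖ := by simpa using hx.1.1
  have hy' : y ∈ ((Metric.closedBall (0 : E) ‖z‖ ∩ L) \ {0}) :=
    ⟨⟨by simpa using hlt.le.trans hxz, hy⟩, by simpa using hy0⟩
  exact absurd (hmin hy' hlt.le) (not_le.2 hlt)

theorem mem_projLattice {L L' : Submodule ℤ E} {V : Submodule ℝ E}
    (hV : Submodule.span ℝ (L : Set E) = V) {y : E} :
    y ∈ projLattice L L' ↔ ∃ z ∈ L', Vᗮ.starProjection z = y := by
  subst hV
  rfl

theorem finrank_span_projLattice {L L' : Submodule ℤ E} [DiscreteTopology L'] (hle : L ≤ L')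
    (hprim : ∀ x ∈ L', x ∈ Submodule.span ℝ (L : Set E) → x ∈ L) :
    finrank ℝ (Submodule.span ℝ (L' : Set E)) = finrank ℝ (Submodule.span ℝ (L : Set E)) +
      finrank ℝ (Submodule.span ℝ (projLattice L L' : Set E)) := by
  obtain ⟨m, n, v, w, h, rfl, rfl⟩ := exists_extended_basis hle hprim
  have hv : LinearIndependent ℝ v := by
    simpa using h.comp Sum.inl Sum.inl_injective
  rw [projLattice_span, span_real_span_int, span_real_span_int, span_real_span_int,
    finrank_span_eq_card h, finrank_span_eq_card hv,
    finrank_span_eq_card (linearIndependent_proj h), Fintype.card_sum]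

theorem exists_sub_zsmul_norm_le (x y : E) :
    ∃ k : ℤ, ‖(ℝ ∙ x).starProjection (y - k • x)‖ ≤ ‖x‖ / 2 := by
  obtain ⟨t, ht⟩ := Submodule.mem_span_singleton.1
    ((ℝ ∙ x).starProjection_apply_mem y)
  refine ⟨round t, ?_⟩
  have hx : (ℝ ∙ x).starProjection x = x :=
    Submodule.starProjection_eq_self_iff.2 (Submodule.mem_span_singleton_self x)
  rw [map_sub, map_zsmul, hx, ← ht, ← Int.cast_smul_eq_zsmul ℝ, ← sub_smul, norm_smul,
    Real.norm_eq_abs]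
  nlinarith [abs_sub_round t, norm_nonneg x]

theorem norm_sq_eq_add_proj (V : Submodule ℝ E) (y : E) :
    ‖y‖ ^ 2 = ‖V.starProjection y‖ ^ 2 + ‖Vᗮ.starProjection y‖ ^ 2 :=
  Submodule.norm_sq_eq_add_norm_sq_starProjection y V

variable [MeasurableSpace E] [BorelSpace E]

theorem covol_span_singleton {x : E} (hx : x ≠ 0) : covol (Submodule.span ℤ {x}) = ‖x‖ := by
  have h := covol_span_sq (v := fun _ : Unit => x) (LinearIndependent.of_subsingleton () hx)
  rw [Set.range_const, Matrix.det_unique, Matrix.gram_apply, real_inner_self_eq_norm_sq] at h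
  exact (pow_left_inj₀ (covol_nonneg _) (norm_nonneg _) two_ne_zero).1 h

variable (E) in
/-- Lattices of rank `n` whose nonzero vectors have norm at least `l` have covolume bounded below,
and are generated by vectors of norm bounded in terms of the covolume. -/
theorem exists_reduction_bounds (n : ℕ) : ∀ l : ℝ, 0 < l → ∀ C : ℝ, ∃ c > 0, ∃ R : ℝ,
    ∀ L : Submodule ℤ E, DiscreteTopology L → finrank ℝ (Submodule.span ℝ (L : Set E)) = n →
      (∀ x ∈ L, x ≠ 0 → l ≤ ‖x‖) → c ≤ covol L ∧
        (covol L ≤ C → ∃ s ⊆ Metric.closedBall (0 : E) R, Submodule.span ℤ s = L) := by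
  induction n with
  | zero =>
    intro l hl C
    refine ⟨1, one_pos, 0, fun L _ hn _ => ?_⟩
    have hL : L = ⊥ := by
      rw [Submodule.finrank_eq_zero, Submodule.span_eq_bot] at hn
      exact (Submodule.eq_bot_iff _).2 hn
    rw [hL]
    exact ⟨covol_bot.ge, fun _ => ⟨∅, Set.empty_subset _, Submodule.span_empty⟩⟩
  | succ n ih =>
    intro l hl C
    -- The induction applies to the projection of `L` orthogonal to a shortest vector `x`. A lift
    -- `z` of a nonzero `y` can be chosen with component at most `‖x‖ / 2` along `x`; since `‖z‖ ≥
    -- ‖x‖`, this forces `‖y‖ ≥ l / 2`. The covolume of the projection is `covol L / ‖x‖ ≤ C / l`.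
    obtain ⟨c, hc, R, hR⟩ := ih (l / 2) (by positivity) (C / l)
    -- The generators are `x`, with `‖x‖ ≤ covol L / c ≤ C / c`, and lifts of generators of norm at
    -- most `R`, of norm at most `R + ‖x‖ / 2`.
    refine ⟨l * c, by positivity, max (C / c) (R + C / c), fun L hd hn hmin => ?_⟩
    have hL : L ≠ ⊥ := by
      rintro rfl
      rw [Submodule.bot_coe, Submodule.span_zero_singleton, finrank_bot] at hn
      omega
    obtain ⟨x, hxL, hx0, hx⟩ := exists_shortest_vector L hL
    have hlx := hmin x hxL hx0
    have hle : Submodule.span ℤ {x} ≤ L := (Submodule.span_singleton_le_iff_mem _ _).2 hxL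
    have hsp : Submodule.span ℝ (Submodule.span ℤ {x} : Set E) = ℝ ∙ x := span_real_span_int _
    have hx0' : 0 < ‖x‖ := norm_pos_iff.2 hx0
    -- A shortest vector is primitive: a multiple of it in `L` can be reduced to norm at most `‖x‖ /
    -- 2`, so to zero.
    have hprim : ∀ y ∈ L, y ∈ Submodule.span ℝ (Submodule.span ℤ {x} : Set E) →
        y ∈ Submodule.span ℤ {x} := by
      intro y hy hy'
      rw [hsp] at hy'
      obtain ⟨k, hk⟩ := exists_sub_zsmul_norm_le x y
      have hmem : y - k • x ∈ ℝ ∙ x := by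
        rw [← Int.cast_smul_eq_zsmul ℝ]
        exact sub_mem hy' (Submodule.smul_mem _ _ (Submodule.mem_span_singleton_self x))
      rw [Submodule.starProjection_eq_self_iff.2 hmem] at hk
      have h0 : y - k • x = 0 := by
        by_contra h0
        have := hx _ (sub_mem hy (zsmul_mem hxL k)) h0
        linarith
      rw [sub_eq_zero.1 h0]
      exact Submodule.smul_mem _ _ (Submodule.mem_span_singleton_self x)
    have hproj : ∀ {T : Submodule ℤ E} (y : E), y ∈ projLattice (Submodule.span ℤ {x}) T ↔
        ∃ z ∈ T, (ℝ ∙ x)ᗮ.starProjection z = y :=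
      fun y => mem_projLattice hsp
    have hlift : ∀ y ∈ projLattice (Submodule.span ℤ {x}) L, ∃ z ∈ L,
        (ℝ ∙ x)ᗮ.starProjection z = y ∧ ‖(ℝ ∙ x).starProjection z‖ ≤ ‖x‖ / 2 := by
      intro y hy
      obtain ⟨z, hz, hzy⟩ := (hproj y).1 hy
      obtain ⟨k, hk⟩ := exists_sub_zsmul_norm_le x z
      refine ⟨z - k • x, sub_mem hz (zsmul_mem hxL k), ?_, hk⟩
      rw [map_sub, map_zsmul,
        starProjection_orthogonal_eq_zero (Submodule.mem_span_singleton_self x), smul_zero,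
        sub_zero, hzy]
    have hvol := covol_eq_mul_projLattice hle hprim
    rw [covol_span_singleton hx0] at hvol
    have hd' := discreteTopology_projLattice hle hprim
    have hrank : finrank ℝ (Submodule.span ℝ (projLattice (Submodule.span ℤ {x}) L : Set E)) = n := by
      have h := finrank_span_projLattice hle hprim
      rw [hn, hsp, finrank_span_singleton hx0] at h
      omega
    obtain ⟨h1, h2⟩ := hR _ hd' hrank (by
      intro y hy hy0
      obtain ⟨z, hz, hzy, hzx⟩ := hlift y hy
      have hz0 : z ≠ 0 := by
        rintro rfl
        rw [map_zero] at hzy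
        exact hy0 hzy.symm
      have h1 := hx z hz hz0
      have h2 := norm_sq_eq_add_proj (ℝ ∙ x) z
      rw [hzy] at h2
      nlinarith [norm_nonneg y, norm_nonneg z, norm_nonneg ((ℝ ∙ x).starProjection z)])
    refine ⟨?_, fun hC => ?_⟩
    · rw [hvol]
      exact mul_le_mul hlx h1 hc.le hx0'.le
    · have hC0 : 0 ≤ C := (covol_nonneg L).trans hC
      have hxC : ‖x‖ ≤ C / c := by
        rw [le_div_iff₀ hc]
        nlinarith
      obtain ⟨s, hs, hsL⟩ := h2 (by
        rw [le_div_iff₀ hl]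
        nlinarith [covol_nonneg (projLattice (Submodule.span ℤ {x}) L)])
      have hsmem : ∀ y ∈ s, y ∈ projLattice (Submodule.span ℤ {x}) L := fun y hy =>
        hsL ▸ Submodule.subset_span hy
      choose! z hzL hzy hzx using hlift
      have hle' : Submodule.span ℤ (insert x (z '' s)) ≤ L := by
        rw [Submodule.span_le]
        rintro _ (rfl | ⟨y, hy, rfl⟩)
        · exact hxL
        · exact hzL y (hsmem y hy)
      refine ⟨insert x (z '' s), ?_, le_antisymm hle' ?_⟩
      · rintro _ (rfl | ⟨y, hy, rfl⟩)
        · rw [mem_closedBall_zero_iff]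
          exact hxC.trans (le_max_left _ _)
        · rw [mem_closedBall_zero_iff]
          refine le_trans ?_ (le_max_right _ _)
          have h3 := hs hy
          rw [mem_closedBall_zero_iff, ← hzy y (hsmem y hy)] at h3
          have h4 := (ℝ ∙ x).starProjection_add_starProjection_orthogonal (z y)
          rw [← h4]
          have h5 := hzx y (hsmem y hy)
          refine (norm_add_le _ _).trans ?_
          linarith
      · intro w hw
        have h3 : Submodule.span ℤ s ≤ projLattice (Submodule.span ℤ {x})
            (Submodule.span ℤ (insert x (z '' s))) := by
          rw [Submodule.span_le]
          intro y hy
          exact (hproj y).2 ⟨z y, Submodule.subset_span (Set.mem_insert_of_mem _ ⟨y, hy, rfl⟩),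
            hzy y (hsmem y hy)⟩
        rw [hsL] at h3
        obtain ⟨t, ht, htw⟩ := (hproj _).1 (h3 ((hproj _).2 ⟨w, hw, rfl⟩))
        have h4 : w - t ∈ Submodule.span ℤ {x} := by
          refine hprim _ (sub_mem hw (hle' ht)) ?_
          rw [hsp, ← (ℝ ∙ x).orthogonal_orthogonal, ← Submodule.starProjection_apply_eq_zero_iff,
            map_sub, htw, sub_self]
        have h5 : w - t ∈ Submodule.span ℤ (insert x (z '' s)) :=
          Submodule.span_mono (Set.singleton_subset_iff.2 (Set.mem_insert _ _)) h4
        simpa using add_mem h5 ht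

variable (E) in
/-- Up to any bound on the covolume, a lattice has only finitely many sublattices. -/
theorem finite_sublattices_covol_le (Λ : Submodule ℤ E) [DiscreteTopology Λ] (C : ℝ) :
    {L : Submodule ℤ E | L ≤ Λ ∧ covol L ≤ C}.Finite := by
  have hl : ∃ l > 0, ∀ x ∈ Λ, x ≠ 0 → l ≤ ‖x‖ := by
    by_cases hΛ : Λ = ⊥
    · refine ⟨1, one_pos, fun x hx hx0 => absurd ?_ hx0⟩
      rwa [hΛ, Submodule.mem_bot] at hx
    · obtain ⟨x, _, hx0, hx⟩ := exists_shortest_vector Λ hΛ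
      exact ⟨‖x‖, norm_pos_iff.2 hx0, hx⟩
  obtain ⟨l, hl, hmin⟩ := hl
  have h : ∀ n, ∃ R : ℝ, ∀ L : Submodule ℤ E, L ≤ Λ → covol L ≤ C →
      finrank ℝ (Submodule.span ℝ (L : Set E)) = n →
      ∃ s ⊆ Metric.closedBall (0 : E) R, Submodule.span ℤ s = L := by
    intro n
    obtain ⟨c, -, R, hR⟩ := exists_reduction_bounds E n l hl C
    exact ⟨R, fun L hL hC hn => (hR L (discreteTopology_of_le hL) hn
      fun x hx => hmin x (hL hx)).2 hC⟩
  choose R hR using h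
  -- In each rank the sublattices in question are generated by subsets of one finite set, the
  -- vectors of `Λ` in a fixed ball.
  have hfin : (⋃ n ∈ Set.Iic (finrank ℝ E),
      Submodule.span ℤ '' (𝒫 (Metric.closedBall (0 : E) (R n) ∩ Λ))).Finite :=
    (Set.finite_Iic _).biUnion fun n _ =>
      (finite_lattice_inter_closedBall Λ (R n)).finite_subsets.image _
  refine hfin.subset fun L ⟨hL, hC⟩ => ?_
  obtain ⟨s, hs, hsL⟩ := hR _ L hL hC rfl
  refine Set.mem_biUnion (x := finrank ℝ (Submodule.span ℝ (L : Set E)))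
    (Submodule.finrank_le _) ⟨s, fun y hy => ⟨hs hy, hL ?_⟩, hsL⟩
  exact hsL ▸ Submodule.subset_span hy

end LatticeReduction

/-! ### Adelic denominators and discreteness of the lattice -/

section Arithmetic

variable {F : Type*} [Field F] [NumberField F] {r : ℕ}

/-- The component of an adele at a finite place. -/
def finiteComponent (v : HeightOneSpectrum (𝓞 F)) : 𝔸[F] →+* v.adicCompletion F :=
  (RestrictedProduct.evalRingHom (fun v : HeightOneSpectrum (𝓞 F) => v.adicCompletion F) v).comp
    (RingHom.snd (NumberField.InfiniteAdeleRing F) (FiniteAdeleRing (𝓞 F) F))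

/-- The component of an adele at an infinite place, as a complex number. -/
def infiniteComponent (σ : NumberField.InfinitePlace F) : 𝔸[F] →+* ℂ :=
  ((NumberField.InfinitePlace.Completion.extensionEmbedding σ).comp
    (Pi.evalRingHom (fun σ : NumberField.InfinitePlace F => σ.Completion) σ)).comp
    (RingHom.fst (NumberField.InfiniteAdeleRing F) (FiniteAdeleRing (𝓞 F) F))

theorem finiteComponent_algebraMap (v : HeightOneSpectrum (𝓞 F)) (x : F) :
    finiteComponent v (algebraMap F 𝔸[F] x) = (x : v.adicCompletion F) := rfl

theorem infiniteComponent_algebraMap (σ : NumberField.InfinitePlace F) (x : F) :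
    infiniteComponent σ (algebraMap F 𝔸[F] x) = σ.embedding x :=
  NumberField.InfinitePlace.Completion.extensionEmbedding_coe _ _

theorem mem_vectorSheaf {g : GL (Fin r) 𝔸[F]} {x : Fin r → F} :
    x ∈ vectorSheaf g ↔ ∀ (v : HeightOneSpectrum (𝓞 F)) (i : Fin r),
      finiteComponent v (adelicCoord g x i) ∈ v.adicCompletionIntegers F := Iff.rfl

theorem archEmbedding_apply (g : GL (Fin r) 𝔸[F]) (x : Fin r → F)
    (a : NumberField.InfinitePlace F × Fin r) :
    archEmbedding g x a = infiniteComponent a.1 (adelicCoord g x a.2) := rfl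

theorem sum_mul_adelicCoord (g : GL (Fin r) 𝔸[F]) (x : Fin r → F) (j : Fin r) :
    ∑ i, (g : Matrix (Fin r) (Fin r) 𝔸[F]) j i * adelicCoord g x i = algebraMap F 𝔸[F] (x j) := by
  have h : (g : Matrix (Fin r) (Fin r) 𝔸[F]).mulVec (adelicCoord g x) =
      fun j => algebraMap F 𝔸[F] (x j) := by
    change (g : Matrix (Fin r) (Fin r) 𝔸[F]).mulVec
      ((g⁻¹ : GL (Fin r) 𝔸[F]).1.mulVec fun j => algebraMap F 𝔸[F] (x j)) = _
    rw [Matrix.mulVec_mulVec, ← Units.val_mul, mul_inv_cancel, Units.val_one, Matrix.one_mulVec]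
  exact congrFun h j

theorem exists_nat_mul_mem_adicCompletionIntegers (v : HeightOneSpectrum (𝓞 F))
    (a : v.adicCompletion F) : ∃ n : ℕ, n ≠ 0 ∧ (n : v.adicCompletion F) * a ∈
      v.adicCompletionIntegers F := by
  obtain ⟨b, hb, hab⟩ := HeightOneSpectrum.adicCompletion.mul_nonZeroDivisor_mem_adicCompletionIntegers v a
  -- The norm turns the denominator `b` into a natural number divisible by it.
  refine ⟨Ideal.absNorm (Ideal.span {b}), ?_, ?_⟩
  · rw [Ne, Ideal.absNorm_eq_zero_iff, Ideal.span_singleton_eq_bot]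
    exact nonZeroDivisors.ne_zero hb
  · obtain ⟨c, hc⟩ := Ideal.mem_span_singleton.1 (Ideal.absNorm_mem (Ideal.span {b}))
    have h1 : ((Ideal.absNorm (Ideal.span {b}) : ℕ) : v.adicCompletion F) =
        algebraMap (𝓞 F) _ b * algebraMap (𝓞 F) _ c := by
      rw [← map_mul, ← hc, map_natCast]
    rw [h1, mul_comm, ← mul_assoc]
    exact mul_mem hab (v.coe_mem_adicCompletionIntegers c)

/-- Every adele has a common denominator at the finite places. -/
theorem exists_nat_mul_finiteComponent_mem (a : 𝔸[F]) : ∃ n : ℕ, n ≠ 0 ∧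
    ∀ v : HeightOneSpectrum (𝓞 F),
      (n : v.adicCompletion F) * finiteComponent v a ∈ v.adicCompletionIntegers F := by
  classical
  have hfin : {v : HeightOneSpectrum (𝓞 F) |
      ¬ finiteComponent v a ∈ v.adicCompletionIntegers F}.Finite :=
    Filter.eventually_cofinite.1 a.2.2
  choose n hn0 hn using fun v : HeightOneSpectrum (𝓞 F) =>
    exists_nat_mul_mem_adicCompletionIntegers v (finiteComponent v a)
  refine ⟨∏ v ∈ hfin.toFinset, n v, Finset.prod_ne_zero_iff.2 fun v _ => hn0 v, fun v => ?_⟩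
  by_cases hv : finiteComponent v a ∈ v.adicCompletionIntegers F
  · exact mul_mem (natCast_mem _ _) hv
  · have hv' : v ∈ hfin.toFinset := hfin.mem_toFinset.2 hv
    rw [← Finset.mul_prod_erase _ _ hv', mul_comm (n v), Nat.cast_mul, mul_assoc]
    exact mul_mem (natCast_mem _ _) (hn v)

theorem exists_nat_mul_finiteComponent_mem_of_finite {ι : Type*} [Fintype ι] (a : ι → 𝔸[F]) :
    ∃ n : ℕ, n ≠ 0 ∧ ∀ i, ∀ v : HeightOneSpectrum (𝓞 F),
      (n : v.adicCompletion F) * finiteComponent v (a i) ∈ v.adicCompletionIntegers F := by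
  classical
  choose n hn0 hn using fun i => exists_nat_mul_finiteComponent_mem (a i)
  refine ⟨∏ i, n i, Finset.prod_ne_zero_iff.2 fun i _ => hn0 i, fun i v => ?_⟩
  rw [← Finset.mul_prod_erase _ _ (Finset.mem_univ i), mul_comm (n i), Nat.cast_mul, mul_assoc]
  exact mul_mem (natCast_mem _ _) (hn i v)

/-- `E_g` spans `F ^ r`. -/
theorem exists_nsmul_mem_vectorSheaf (g : GL (Fin r) 𝔸[F]) (x : Fin r → F) :
    ∃ n : ℕ, n ≠ 0 ∧ n • x ∈ vectorSheaf g := by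
  obtain ⟨n, hn0, hn⟩ := exists_nat_mul_finiteComponent_mem_of_finite (adelicCoord g x)
  refine ⟨n, hn0, mem_vectorSheaf.2 fun v i => ?_⟩
  rw [map_nsmul, Pi.smul_apply, map_nsmul, nsmul_eq_mul]
  exact hn i v

/-- The elements of `E_g` have a common denominator. -/
theorem exists_nat_mul_isIntegral (g : GL (Fin r) 𝔸[F]) :
    ∃ n : ℕ, n ≠ 0 ∧ ∀ x ∈ vectorSheaf g, ∀ j, IsIntegral ℤ ((n : F) * x j) := by
  obtain ⟨n, hn0, hn⟩ := exists_nat_mul_finiteComponent_mem_of_finite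
    fun ij : Fin r × Fin r => (g : Matrix (Fin r) (Fin r) 𝔸[F]) ij.1 ij.2
  refine ⟨n, hn0, fun x hx j => ?_⟩
  -- From `x = g (g⁻¹ x)`, a common denominator of the entries of `g` makes `x` integral at every
  -- finite place.
  obtain ⟨y, hy⟩ := HeightOneSpectrum.mem_integers_of_valuation_le_one (R := 𝓞 F) F
      ((n : F) * x j) fun v => by
    rw [← HeightOneSpectrum.valuedAdicCompletion_eq_valuation',
      ← HeightOneSpectrum.mem_adicCompletionIntegers, ← finiteComponent_algebraMap, map_mul,
      map_natCast, map_mul, map_natCast, ← sum_mul_adelicCoord g, map_sum, Finset.mul_sum]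
    refine sum_mem fun i _ => ?_
    rw [map_mul, ← mul_assoc]
    exact mul_mem (hn (j, i) v) (hx v i)
  rw [← hy]
  exact y.isIntegral_coe

theorem archEmbedding_injective (g : GL (Fin r) 𝔸[F]) : Function.Injective (archEmbedding g) := by
  rw [injective_iff_map_eq_zero]
  intro x hx
  ext j
  obtain ⟨σ⟩ : Nonempty (NumberField.InfinitePlace F) := inferInstance
  have h := congrArg (infiniteComponent σ) (sum_mul_adelicCoord g x j)
  rw [infiniteComponent_algebraMap, map_sum] at h
  refine σ.embedding.injective ?_
  rw [← h, Pi.zero_apply, map_zero]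
  refine Finset.sum_eq_zero fun i _ => ?_
  rw [map_mul, ← archEmbedding_apply g x (σ, i), hx]
  exact mul_zero _

/-- Up to a common denominator the coordinates of a point of `E_g` are algebraic integers, and a
bound on the archimedean norm bounds all their conjugates. Only finitely many elements of `F`
satisfy such bounds. -/
theorem discreteTopology_lattice_top (g : GL (Fin r) 𝔸[F]) : DiscreteTopology (lattice g ⊤) := by
  obtain ⟨n, hn0, hn⟩ := exists_nat_mul_isIntegral g
  refine discreteTopology_of_finite_inter_closedBall _ ?_
  set B : ℝ := ∑ σ : NumberField.InfinitePlace F, ∑ j, n * ∑ i,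
    ‖infiniteComponent σ ((g : Matrix (Fin r) (Fin r) 𝔸[F]) j i)‖
  have hfin := Set.Finite.pi fun _ : Fin r => NumberField.Embeddings.finite_of_norm_le F ℂ B
  have hinj : Function.Injective fun x : Fin r → F => fun j => (n : F) * x j := fun x y hxy => by
    ext j
    exact mul_left_cancel₀ (Nat.cast_ne_zero.2 hn0) (congrFun hxy j)
  refine ((hfin.preimage hinj.injOn).image (archEmbedding g)).subset ?_
  rintro _ ⟨hb, x, ⟨hx, -⟩, rfl⟩
  refine ⟨x, fun j _ => ⟨hn x hx j, fun φ => ?_⟩, rfl⟩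
  have hb1 : ‖archEmbedding g x‖ ≤ 1 := by simpa using hb
  set σ := NumberField.InfinitePlace.mk φ
  have h1 : ‖φ (x j)‖ ≤ ∑ i, ‖infiniteComponent σ ((g : Matrix (Fin r) (Fin r) 𝔸[F]) j i)‖ := by
    rw [← NumberField.InfinitePlace.apply, ← NumberField.InfinitePlace.norm_embedding_eq,
      ← infiniteComponent_algebraMap, ← sum_mul_adelicCoord g, map_sum]
    refine (norm_sum_le _ _).trans (Finset.sum_le_sum fun i _ => ?_)
    rw [map_mul, norm_mul]
    refine mul_le_of_le_one_right (norm_nonneg _) ?_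
    exact (PiLp.norm_apply_le (archEmbedding g x) (σ, i)).trans hb1
  have h2 : ‖φ ((n : F) * x j)‖ ≤ n * ∑ i,
      ‖infiniteComponent σ ((g : Matrix (Fin r) (Fin r) 𝔸[F]) j i)‖ := by
    rw [map_mul, map_natCast, norm_mul, Complex.norm_natCast]
    gcongr
  refine h2.trans ((Finset.single_le_sum (f := fun j => (n : ℝ) * ∑ i,
      ‖infiniteComponent σ ((g : Matrix (Fin r) (Fin r) 𝔸[F]) j i)‖)
    (fun j _ => by positivity) (Finset.mem_univ j)).trans ?_)
  exact Finset.single_le_sum (f := fun σ => ∑ j, (n : ℝ) * ∑ i,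
      ‖infiniteComponent σ ((g : Matrix (Fin r) (Fin r) 𝔸[F]) j i)‖)
    (fun j _ => by positivity) (Finset.mem_univ σ)

end Arithmetic

/-- Otherwise `z` together with a basis of `L` would be independent over `ℤ`, hence over `ℝ` because
`Λ` is discrete. -/
theorem exists_zsmul_mem_of_mem_span {E : Type*} [NormedAddCommGroup E] [InnerProductSpace ℝ E]
    [FiniteDimensional ℝ E] {Λ L : Submodule ℤ E} [DiscreteTopology Λ] (hL : L ≤ Λ) {z : E}
    (hz : z ∈ Λ) (hzL : z ∈ Submodule.span ℝ (L : Set E)) : ∃ n : ℤ, n ≠ 0 ∧ n • z ∈ L := by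
  by_contra! h
  have := discreteTopology_of_le hL
  obtain ⟨m, v, hv, hvL⟩ := exists_lattice_basis L
  have hz0 : z ≠ 0 := by
    rintro rfl
    exact h 1 one_ne_zero (by simp)
  have hzI : LinearIndependent ℝ fun _ : Unit => z := LinearIndependent.of_subsingleton () hz0
  have hlin : LinearIndependent ℤ (Sum.elim v fun _ : Unit => z) := by
    refine (linearIndependent_int_of_real hv).sum_type (linearIndependent_int_of_real hzI) ?_
    rw [Submodule.disjoint_def]
    intro x hx hx'
    rw [Set.range_const, Submodule.mem_span_singleton] at hx'
    obtain ⟨n, rfl⟩ := hx'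
    by_contra hn
    exact h n (fun h0 => hn (by simp [h0])) (hvL ▸ hx)
  have hR := linearIndependent_real_of_int (L := Λ) hlin fun i => by
    rcases i with i | i
    · exact hL (hvL ▸ Submodule.subset_span ⟨i, rfl⟩)
    · exact hz
  have hd := (linearIndependent_sum.1 hR).2.2
  simp only [Sum.elim_comp_inl, Sum.elim_comp_inr] at hd
  rw [Submodule.disjoint_def] at hd
  refine hz0 (hd z ?_ (Submodule.subset_span ⟨(), rfl⟩))
  rwa [hvL, span_real_span_int] at hzL

/-! ### Degrees: supermodularity, finiteness and slopes -/

section Degree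

variable {F : Type*} [Field F] [NumberField F] {r : ℕ}

theorem lattice_mono (g : GL (Fin r) 𝔸[F]) : Monotone (lattice g) := fun _ _ h =>
  Submodule.map_mono (inf_le_inf_left _ h)

instance discreteTopology_lattice (g : GL (Fin r) 𝔸[F]) (W : Submodule F (Fin r → F)) :
    DiscreteTopology (lattice g W) :=
  have := discreteTopology_lattice_top g
  discreteTopology_of_le (lattice_mono g le_top)

theorem archEmbedding_mem_lattice {g : GL (Fin r) 𝔸[F]} {W : Submodule F (Fin r → F)}
    {x : Fin r → F} : archEmbedding g x ∈ lattice g W ↔ x ∈ vectorSheaf g ∧ x ∈ W := by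
  constructor
  · rintro ⟨y, ⟨hy, hyW⟩, hxy⟩
    rw [← archEmbedding_injective g hxy]
    exact ⟨hy, hyW⟩
  · intro h
    exact ⟨x, h, rfl⟩

theorem lattice_inf (g : GL (Fin r) 𝔸[F]) (A B : Submodule F (Fin r → F)) :
    lattice g (A ⊓ B) = lattice g A ⊓ lattice g B := by
  refine le_antisymm (le_inf (lattice_mono g inf_le_left) (lattice_mono g inf_le_right)) ?_
  rintro _ ⟨⟨x, ⟨hx, hxA⟩, rfl⟩, hxB⟩
  exact archEmbedding_mem_lattice.2 ⟨hx, hxA, (archEmbedding_mem_lattice.1 hxB).2⟩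

/-- Some nonzero multiple of `z` comes from `W`, and `W` is closed under division by nonzero
integers. -/
theorem lattice_primitive (g : GL (Fin r) 𝔸[F]) (W : Submodule F (Fin r → F)) {z : Ambient F r}
    (hz : z ∈ lattice g ⊤) (hzW : z ∈ Submodule.span ℝ (lattice g W : Set (Ambient F r))) :
    z ∈ lattice g W := by
  obtain ⟨n, hn0, hn⟩ := exists_zsmul_mem_of_mem_span (lattice_mono g le_top) hz hzW
  obtain ⟨x, ⟨hx, -⟩, rfl⟩ := hz
  change archEmbedding g x ∈ _
  change n • archEmbedding g x ∈ _ at hn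
  rw [← map_zsmul, archEmbedding_mem_lattice] at hn
  refine archEmbedding_mem_lattice.2 ⟨hx, ?_⟩
  have h := hn.2
  rw [← Int.cast_smul_eq_zsmul F] at h
  exact (W.smul_mem_iff (Int.cast_ne_zero.2 hn0)).1 h

/-- The lattice of `A ⊔ B` can exceed the sum of the two lattices, but only by denominators, which
the real span absorbs. -/
theorem lattice_subset_span (g : GL (Fin r) 𝔸[F]) (A B : Submodule F (Fin r → F)) :
    (lattice g (A ⊔ B) : Set (Ambient F r)) ⊆
      Submodule.span ℝ ((lattice g A ⊔ lattice g B : Submodule ℤ _) : Set (Ambient F r)) := by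
  rintro _ ⟨x, ⟨-, hx⟩, rfl⟩
  change archEmbedding g x ∈ _
  obtain ⟨a, ha, b, hb, rfl⟩ := Submodule.mem_sup.1 hx
  have key : ∀ (W : Submodule F (Fin r → F)) (y : Fin r → F), y ∈ W →
      lattice g W ≤ lattice g A ⊔ lattice g B → archEmbedding g y ∈
      Submodule.span ℝ ((lattice g A ⊔ lattice g B : Submodule ℤ _) : Set (Ambient F r)) := by
    intro W y hy hW
    obtain ⟨n, hn0, hn⟩ := exists_nsmul_mem_vectorSheaf g y
    have h1 : archEmbedding g (n • y) ∈ lattice g W :=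
      archEmbedding_mem_lattice.2 ⟨hn, W.smul_of_tower_mem n hy⟩
    have h2 := Submodule.subset_span (R := ℝ) (hW h1)
    rw [map_nsmul, ← Nat.cast_smul_eq_nsmul ℝ] at h2
    exact (Submodule.smul_mem_iff _ (Nat.cast_ne_zero.2 hn0)).1 h2
  rw [map_add]
  exact add_mem (key A a ha le_sup_left) (key B b hb le_sup_right)

theorem lattice_injective (g : GL (Fin r) 𝔸[F]) : Function.Injective (lattice g) := by
  have key : ∀ A B : Submodule F (Fin r → F), lattice g A ≤ lattice g B → A ≤ B := by
    intro A B h x hx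
    obtain ⟨n, hn0, hn⟩ := exists_nsmul_mem_vectorSheaf g x
    have h1 := (archEmbedding_mem_lattice.1 (h (archEmbedding_mem_lattice.2
      ⟨hn, A.smul_of_tower_mem n hx⟩))).2
    rw [← Nat.cast_smul_eq_nsmul F] at h1
    exact (Submodule.smul_mem_iff _ (Nat.cast_ne_zero.2 hn0)).1 h1
  exact fun A B h => le_antisymm (key A B h.le) (key B A h.ge)

theorem lebesgueVolume_eq_covol (L : Submodule ℤ (Ambient F r)) : lebesgueVolume L = covol L := rfl

variable (F) in
/-- The contribution of the normalization of volumes to the degree, per unit of rank. -/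
def degreeConstant : ℝ :=
  Real.log |(NumberField.discr F : ℝ)| / 2 -
    NumberField.InfinitePlace.nrComplexPlaces F * Real.log 2

theorem degree_eq (k : ℕ) (L : Submodule ℤ (Ambient F r)) [DiscreteTopology L] :
    degree k L = k * degreeConstant F - Real.log (covol L) := by
  rw [degree, canonicalVolume, lebesgueVolume_eq_covol,
    Real.log_mul (by positivity) (covol_pos L).ne', Real.log_pow, degreeConstant]
  push_cast
  ring

theorem subDegree_eq (g : GL (Fin r) 𝔸[F]) (W : Submodule F (Fin r → F)) :
    subDegree g W = finrank F W * degreeConstant F - Real.log (covol (lattice g W)) :=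
  degree_eq _ _

theorem vertex_eq (g : GL (Fin r) 𝔸[F]) (W : Submodule F (Fin r → F)) :
    vertex g W = finrank F W * (degreeConstant F - subDegree g ⊤ / r) -
      Real.log (covol (lattice g W)) := by
  rw [vertex, subDegree_eq]
  ring

theorem vertex_bot (g : GL (Fin r) 𝔸[F]) : vertex g ⊥ = 0 := by
  have h : lattice g ⊥ = ⊥ := by
    rw [Submodule.eq_bot_iff]
    rintro _ ⟨x, ⟨-, hx⟩, rfl⟩
    rw [(Submodule.mem_bot F).1 hx]
    exact map_zero _
  rw [vertex_eq, h, covol_bot]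
  simp

theorem vertex_top (hr : 0 < r) (g : GL (Fin r) 𝔸[F]) : vertex g ⊤ = 0 := by
  rw [vertex, finrank_top, finrank_fin_fun, mul_div_cancel₀ _ (Nat.cast_ne_zero.2 hr.ne'), sub_self]

/-- The function `W ↦ deg Λ^g_W` is supermodular. -/
theorem vertex_add_vertex_le (g : GL (Fin r) 𝔸[F]) (A B : Submodule F (Fin r → F)) :
    vertex g A + vertex g B ≤ vertex g (A ⊓ B) + vertex g (A ⊔ B) := by
  have := discreteTopology_lattice_top g
  have h := covol_sup_mul_covol_inf_le (Λ := lattice g ⊤) (A := lattice g A) (B := lattice g B)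
    (lattice_mono g le_sup_left) (lattice_mono g le_sup_right) (lattice_mono g le_top)
    (lattice_subset_span g A B) fun x hx hx' => by
      rw [← lattice_inf] at hx'
      have := lattice_primitive g _ (lattice_mono g le_top hx) hx'
      exact lattice_mono g inf_le_left this
  rw [← lattice_inf] at h
  have hlog := Real.log_le_log (mul_pos (covol_pos _) (covol_pos _)) h
  rw [Real.log_mul (covol_pos _).ne' (covol_pos _).ne',
    Real.log_mul (covol_pos _).ne' (covol_pos _).ne'] at hlog
  have hdim : (finrank F (A ⊔ B : Submodule F (Fin r → F)) : ℝ) +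
      finrank F (A ⊓ B : Submodule F (Fin r → F)) = finrank F A + finrank F B := by
    exact_mod_cast Submodule.finrank_sup_add_finrank_inf_eq A B
  -- The term linear in the rank is modular, so only the logarithms of the covolumes matter.
  simp only [vertex_eq]
  linear_combination hlog - (degreeConstant F - subDegree g ⊤ / r) * hdim

theorem finite_setOf_le_vertex (g : GL (Fin r) 𝔸[F]) (C : ℝ) :
    {W : Submodule F (Fin r → F) | C ≤ vertex g W}.Finite := by
  have := discreteTopology_lattice_top g
  set c := degreeConstant F - subDegree g ⊤ / r with hc
  -- The rank term of the vertex is at most `r * |c|`, so a lower bound `C` on the vertex bounds the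
  -- logarithm of the covolume by `r * |c| - C`.
  have hfin := finite_sublattices_covol_le (Ambient F r) (lattice g ⊤)
    (Real.exp (r * |c| - C))
  refine (hfin.preimage (lattice_injective g).injOn).subset fun W hW => ?_
  refine ⟨lattice_mono g le_top, ?_⟩
  rw [← Real.log_le_iff_le_exp (covol_pos _)]
  have h1 : C ≤ finrank F W * c - Real.log (covol (lattice g W)) := by
    rw [hc, ← vertex_eq]
    exact hW
  have h2 : (finrank F W : ℝ) ≤ r := by
    have := Submodule.finrank_le W
    rw [finrank_fin_fun] at this
    exact_mod_cast this
  have h3 : (finrank F W : ℝ) * c ≤ r * |c| :=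
    (mul_le_mul_of_nonneg_left (le_abs_self c) (Nat.cast_nonneg _)).trans
      (mul_le_mul_of_nonneg_right h2 (abs_nonneg c))
  linarith

/-- Multiplicativity of covolumes makes the degree additive. Normalization by the total slope shifts
all slopes by one constant, so the canonical filtration can be studied through `vertex g` alone. -/
theorem slope_eq (g : GL (Fin r) 𝔸[F]) {W W' : Submodule F (Fin r → F)} (h : W < W') :
    slope g W W' = (vertex g W' - vertex g W) / ((finrank F W' : ℝ) - finrank F W) +
      subDegree g ⊤ / r := by
  have hlt := Submodule.finrank_lt_finrank_of_lt h
  have hprim : ∀ x ∈ lattice g W', x ∈ Submodule.span ℝ (lattice g W : Set (Ambient F r)) →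
      x ∈ lattice g W := fun x hx => lattice_primitive g W (lattice_mono g le_top hx)
  have hle := lattice_mono g h.le
  have hd : DiscreteTopology (quotientLattice g W W') := discreteTopology_projLattice hle hprim
  have hvol : covol (lattice g W') = covol (lattice g W) * covol (quotientLattice g W W') :=
    covol_eq_mul_projLattice hle hprim
  have hlog := congrArg Real.log hvol
  rw [Real.log_mul (covol_pos _).ne' (covol_pos _).ne'] at hlog
  have hne : (finrank F W' : ℝ) - finrank F W ≠ 0 := by
    rw [sub_ne_zero]
    exact_mod_cast hlt.ne'
  rw [slope, degree_eq, Nat.cast_sub hlt.le, vertex_eq, vertex_eq, div_add' _ _ _ hne]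
  congr 1
  linear_combination hlog

/-- Transport of structure: `(γ g)⁻¹ (γ x) = g⁻¹ x`, so `x ↦ γ x` preserves integrality and
archimedean coordinates. -/
theorem lattice_toAdelic_mul (γ : GL (Fin r) F) (g : GL (Fin r) 𝔸[F])
    (W : Submodule F (Fin r → F)) :
    lattice (toAdelic F F r γ * g) (W.map (γ : Matrix (Fin r) (Fin r) F).mulVecLin) =
      lattice g W := by
  have key : ∀ (γ : GL (Fin r) F) (g : GL (Fin r) 𝔸[F]) (W : Submodule F (Fin r → F)),
      lattice g W ≤
        lattice (toAdelic F F r γ * g) (W.map (γ : Matrix (Fin r) (Fin r) F).mulVecLin) := by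
    rintro γ g W _ ⟨x, ⟨hx, hxW⟩, rfl⟩
    refine ⟨(γ : Matrix (Fin r) (Fin r) F).mulVec x, ⟨fun v i => ?_, ⟨x, hxW, rfl⟩⟩, ?_⟩
    · rw [adelicCoord_toAdelic]
      exact hx v i
    · change archEmbedding _ _ = archEmbedding _ _
      ext a
      rw [archEmbedding_apply, archEmbedding_apply, adelicCoord_toAdelic]
  refine le_antisymm ?_ (key γ g W)
  have h := key γ⁻¹ (toAdelic F F r γ * g) (W.map (γ : Matrix (Fin r) (Fin r) F).mulVecLin)
  rwa [← mul_assoc, ← map_mul, inv_mul_cancel, map_one, one_mul, ← Submodule.map_comp,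
    ← Matrix.mulVecLin_mul, ← Units.val_mul, inv_mul_cancel, Units.val_one, Matrix.mulVecLin_one,
    Submodule.map_id] at h

theorem vertex_toAdelic_mul (γ : GL (Fin r) F) (g : GL (Fin r) 𝔸[F])
    (W : Submodule F (Fin r → F)) :
    vertex (toAdelic F F r γ * g) (W.map (γ : Matrix (Fin r) (Fin r) F).mulVecLin) =
      vertex g W := by
  have hinj : Function.Injective (γ : Matrix (Fin r) (Fin r) F).mulVecLin :=
    Matrix.mulVec_injective_of_isUnit γ.isUnit
  have htop : lattice (toAdelic F F r γ * g) ⊤ = lattice g ⊤ := by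
    have h := lattice_toAdelic_mul γ g ⊤
    rwa [Submodule.map_top, LinearMap.range_eq_top.2
      (LinearMap.injective_iff_surjective.1 hinj)] at h
  simp only [vertex, subDegree, lattice_toAdelic_mul, htop,
    (Submodule.equivMapOfInjective _ hinj W).symm.finrank_eq]

end Degree

/-! ### Harder-Narasimhan filtrations -/

section HarderNarasimhan

variable {F : Type*} [Field F] {r : ℕ}

/-- The subspaces of a filtration, indexed by the natural numbers. -/
def Filtration.nth (𝓕 : Filtration F r) (n : ℕ) : Submodule F (Fin r → F) :=
  𝓕.space ⟨min n 𝓕.length, by omega⟩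

namespace Filtration

variable (𝓕 : Filtration F r)

theorem nth_eq {n : ℕ} (h : n < 𝓕.length + 1) : 𝓕.nth n = 𝓕.space ⟨n, h⟩ := by
  rw [nth]
  congr
  omega

theorem space_castSucc (i : Fin 𝓕.length) : 𝓕.space i.castSucc = 𝓕.nth i :=
  (𝓕.nth_eq _).symm

theorem space_succ (i : Fin 𝓕.length) : 𝓕.space i.succ = 𝓕.nth (i + 1) :=
  (𝓕.nth_eq _).symm

theorem nth_zero : 𝓕.nth 0 = ⊥ := by
  rw [nth_eq 𝓕 (Nat.succ_pos _)]
  exact 𝓕.space_zero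

theorem nth_length : 𝓕.nth 𝓕.length = ⊤ := by
  rw [nth_eq 𝓕 (Nat.lt_succ_self _)]
  exact 𝓕.space_last

theorem nth_mono : Monotone 𝓕.nth := fun _ _ h =>
  𝓕.strictMono.monotone (Fin.mk_le_mk.2 (min_le_min_right _ h))

theorem nth_lt {m n : ℕ} (h : m < n) (hn : n ≤ 𝓕.length) : 𝓕.nth m < 𝓕.nth n := by
  rw [nth_eq 𝓕 (by omega : m < _), nth_eq 𝓕 (by omega : n < _)]
  exact 𝓕.strictMono h

theorem nth_eq_top_iff {n : ℕ} : 𝓕.nth n = ⊤ ↔ 𝓕.length ≤ n := by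
  constructor
  · intro h
    by_contra! hlt
    have := 𝓕.nth_lt hlt le_rfl
    rw [h] at this
    exact not_top_lt this
  · intro h
    exact top_le_iff.1 (𝓕.nth_length ▸ 𝓕.nth_mono h)

theorem ext_nth {𝓕 𝓖 : Filtration F r} (h : ∀ n, 𝓕.nth n = 𝓖.nth n) : 𝓕 = 𝓖 := by
  have hl : 𝓕.length = 𝓖.length :=
    le_antisymm (𝓕.nth_eq_top_iff.1 ((h _).trans 𝓖.nth_length))
      (𝓖.nth_eq_top_iff.1 ((h _).symm.trans 𝓕.nth_length))
  have hs : ∀ n (h1 : n < 𝓕.length + 1) (h2 : n < 𝓖.length + 1),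
      𝓕.space ⟨n, h1⟩ = 𝓖.space ⟨n, h2⟩ := fun n h1 h2 => by
    rw [← nth_eq, ← nth_eq, h]
  obtain ⟨l, s, _, _, _⟩ := 𝓕
  obtain ⟨l', s', _, _, _⟩ := 𝓖
  obtain rfl : l = l' := hl
  obtain rfl : s = s' := funext fun i => hs i i.2 i.2
  rfl

end Filtration

/-- The slope of the chord between the points `(dim W, v W)` and `(dim U, v U)`. -/
def chord (v : Submodule F (Fin r → F) → ℝ) (W U : Submodule F (Fin r → F)) : ℝ :=
  (v U - v W) / ((finrank F U : ℝ) - finrank F W)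

/-- The Harder-Narasimhan filtrations for a function on the subspaces of `F ^ r`. -/
structure IsHarderNarasimhan (v : Submodule F (Fin r → F) → ℝ) (𝓕 : Filtration F r) : Prop where
  semistable : ∀ n < 𝓕.length, ∀ U, 𝓕.nth n < U → U ≤ 𝓕.nth (n + 1) →
    chord v (𝓕.nth n) U ≤ chord v (𝓕.nth n) (𝓕.nth (n + 1))
  chord_lt : ∀ n, n + 1 < 𝓕.length →
    chord v (𝓕.nth (n + 1)) (𝓕.nth (n + 2)) < chord v (𝓕.nth n) (𝓕.nth (n + 1))

/-- The polygon of a filtration, for a function on the subspaces of `F ^ r`. -/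
def filtrationPolygon (v : Submodule F (Fin r → F) → ℝ) (𝓕 : Filtration F r) (x : ℝ) : ℝ :=
  ∑ n ∈ Finset.range 𝓕.length, chord v (𝓕.nth n) (𝓕.nth (n + 1)) *
    (min (max x (finrank F (𝓕.nth n))) (finrank F (𝓕.nth (n + 1))) - finrank F (𝓕.nth n))

theorem finrank_lt_cast {W U : Submodule F (Fin r → F)} (h : W < U) :
    (finrank F W : ℝ) < finrank F U :=
  Nat.cast_lt.2 (Submodule.finrank_lt_finrank_of_lt h)

theorem finrank_le_cast {W U : Submodule F (Fin r → F)} (h : W ≤ U) :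
    (finrank F W : ℝ) ≤ finrank F U :=
  Nat.cast_le.2 (Submodule.finrank_mono h)

theorem finrank_sup_add_inf_cast (A B : Submodule F (Fin r → F)) :
    (finrank F (A ⊔ B : Submodule F (Fin r → F)) : ℝ) +
      finrank F (A ⊓ B : Submodule F (Fin r → F)) = finrank F A + finrank F B := by
  exact_mod_cast Submodule.finrank_sup_add_finrank_inf_eq A B

theorem chord_mul {v : Submodule F (Fin r → F) → ℝ} {W U : Submodule F (Fin r → F)} (h : W < U) :
    chord v W U * ((finrank F U : ℝ) - finrank F W) = v U - v W :=
  div_mul_cancel₀ _ (sub_pos.2 (finrank_lt_cast h)).ne'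

section polygon

variable (v : Submodule F (Fin r → F) → ℝ) (𝓕 : Filtration F r)

/-- The summands before `j` are full increments and telescope; those after `j` vanish by the
truncation. -/
theorem filtrationPolygon_eq {j : ℕ} (hj : j < 𝓕.length) {x : ℝ}
    (h1 : (finrank F (𝓕.nth j) : ℝ) ≤ x) (h2 : x ≤ finrank F (𝓕.nth (j + 1))) :
    filtrationPolygon v 𝓕 x = v (𝓕.nth j) - v ⊥ +
      chord v (𝓕.nth j) (𝓕.nth (j + 1)) * (x - finrank F (𝓕.nth j)) := by
  have hlow : ∀ m ≤ j, ∑ n ∈ Finset.range m, chord v (𝓕.nth n) (𝓕.nth (n + 1)) *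
      (min (max x (finrank F (𝓕.nth n))) (finrank F (𝓕.nth (n + 1))) - finrank F (𝓕.nth n)) =
      v (𝓕.nth m) - v ⊥ := by
    intro m hm
    induction m with
    | zero => rw [Finset.sum_range_zero, 𝓕.nth_zero, sub_self]
    | succ m ih =>
      have ha : (finrank F (𝓕.nth m) : ℝ) ≤ x :=
        (finrank_le_cast (𝓕.nth_mono (by omega))).trans h1
      have hb : (finrank F (𝓕.nth (m + 1)) : ℝ) ≤ x :=
        (finrank_le_cast (𝓕.nth_mono hm)).trans h1
      rw [Finset.sum_range_succ, ih (by omega), max_eq_left ha, min_eq_right hb,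
        chord_mul (𝓕.nth_lt (Nat.lt_succ_self m) (by omega))]
      ring
  rw [filtrationPolygon, ← Finset.sum_range_add_sum_Ico _ (show j + 1 ≤ 𝓕.length from hj),
    Finset.sum_range_succ, hlow j le_rfl, max_eq_left h1, min_eq_left h2, Finset.sum_eq_zero,
    add_zero]
  intro n hn
  have hn1 := (Finset.mem_Ico.1 hn).1
  have h3 : x ≤ finrank F (𝓕.nth n) := h2.trans (finrank_le_cast (𝓕.nth_mono hn1))
  rw [max_eq_right h3, min_eq_left (finrank_le_cast (𝓕.nth_mono n.le_succ)), sub_self, mul_zero]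

theorem filtrationPolygon_vertex {j : ℕ} (hj : j ≤ 𝓕.length) (hr : 0 < r) :
    filtrationPolygon v 𝓕 (finrank F (𝓕.nth j)) = v (𝓕.nth j) - v ⊥ := by
  rcases hj.lt_or_eq with hj | rfl
  · rw [filtrationPolygon_eq v 𝓕 hj le_rfl (finrank_le_cast (𝓕.nth_mono j.le_succ)), sub_self,
      mul_zero, add_zero]
  · obtain ⟨l, hl⟩ : ∃ l, 𝓕.length = l + 1 := by
      refine Nat.exists_eq_succ_of_ne_zero fun h0 => ?_
      have h1 := 𝓕.nth_zero
      rw [← h0, 𝓕.nth_length] at h1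
      have := congrArg (fun W : Submodule F (Fin r → F) => finrank F W) h1
      simp at this
      omega
    rw [hl, filtrationPolygon_eq v 𝓕 (j := l) (by omega) (finrank_le_cast (𝓕.nth_mono l.le_succ))
      le_rfl, chord_mul (𝓕.nth_lt (Nat.lt_succ_self l) hl.ge)]
    ring

theorem exists_step {x : ℝ} (h0 : 0 ≤ x) (hr : 0 < r) (hx : x ≤ r) :
    ∃ j < 𝓕.length, (finrank F (𝓕.nth j) : ℝ) ≤ x ∧ x ≤ finrank F (𝓕.nth (j + 1)) := by
  classical
  have hex : ∃ n, x ≤ finrank F (𝓕.nth (n + 1)) := by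
    refine ⟨𝓕.length, ?_⟩
    rw [𝓕.nth_eq_top_iff.2 (Nat.le_succ _), finrank_top, finrank_fin_fun]
    exact hx
  have hlen : 0 < 𝓕.length := by
    refine Nat.pos_of_ne_zero fun h0 => ?_
    have h1 := 𝓕.nth_zero
    rw [← h0, 𝓕.nth_length] at h1
    have := congrArg (fun W : Submodule F (Fin r → F) => finrank F W) h1
    simp at this
    omega
  have hspec := Nat.find_spec hex
  refine ⟨Nat.find hex, ?_, ?_, hspec⟩
  · by_contra! hle
    refine Nat.find_min hex (m := 𝓕.length - 1) (by omega) ?_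
    rw [Nat.sub_add_cancel hlen, 𝓕.nth_length, finrank_top, finrank_fin_fun]
    exact hx
  · rcases Nat.eq_zero_or_pos (Nat.find hex) with h | h
    · rw [h, 𝓕.nth_zero, finrank_bot, Nat.cast_zero]
      exact h0
    · have := Nat.find_min hex (m := Nat.find hex - 1) (by omega)
      rw [Nat.sub_add_cancel h] at this
      exact (not_le.1 this).le

end polygon

section supermodular

variable {v : Submodule F (Fin r → F) → ℝ}
  (hv : ∀ A B, v A + v B ≤ v (A ⊓ B) + v (A ⊔ B)) {𝓕 : Filtration F r}

include hv in
-- Supermodularity for `U ⊓ Wₙ₊₁` and `Wₙ` passes from `U` to their sum `X`, which lies between `Wₙ`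
-- and `Wₙ₊₁`, so semistability applies to it. The two dimension increments agree.
theorem IsHarderNarasimhan.step_le (h : IsHarderNarasimhan v 𝓕) (U : Submodule F (Fin r → F))
    {n : ℕ} (hn : n < 𝓕.length) :
    v (U ⊓ 𝓕.nth (n + 1)) - v (U ⊓ 𝓕.nth n) ≤ chord v (𝓕.nth n) (𝓕.nth (n + 1)) *
      ((finrank F (U ⊓ 𝓕.nth (n + 1) : Submodule F (Fin r → F)) : ℝ) -
        finrank F (U ⊓ 𝓕.nth n : Submodule F (Fin r → F))) := by
  have hle : 𝓕.nth n ≤ 𝓕.nth (n + 1) := 𝓕.nth_mono n.le_succ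
  have hinf : U ⊓ 𝓕.nth (n + 1) ⊓ 𝓕.nth n = U ⊓ 𝓕.nth n := by
    rw [inf_assoc, inf_eq_right.2 hle]
  have h1 := hv (U ⊓ 𝓕.nth (n + 1)) (𝓕.nth n)
  have h2 := finrank_sup_add_inf_cast (U ⊓ 𝓕.nth (n + 1)) (𝓕.nth n)
  rw [hinf] at h1 h2
  set X := U ⊓ 𝓕.nth (n + 1) ⊔ 𝓕.nth n
  have h3 : v X - v (𝓕.nth n) ≤ chord v (𝓕.nth n) (𝓕.nth (n + 1)) *
      ((finrank F X : ℝ) - finrank F (𝓕.nth n)) := by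
    rcases (le_sup_right : 𝓕.nth n ≤ X).eq_or_lt with heq | hlt
    · rw [show X = 𝓕.nth n from heq.symm]
      simp
    · rw [← chord_mul hlt]
      exact mul_le_mul_of_nonneg_right
        (h.semistable n hn X hlt (sup_le inf_le_right hle)) (sub_pos.2 (finrank_lt_cast hlt)).le
  rw [show (finrank F (U ⊓ 𝓕.nth (n + 1) : Submodule F (Fin r → F)) : ℝ) -
    finrank F (U ⊓ 𝓕.nth n : Submodule F (Fin r → F)) =
      (finrank F X : ℝ) - finrank F (𝓕.nth n) by linarith]
  linarith

include hv in
-- Later slopes are smaller, so the whole part of `U` beyond `Wₙ` grows at most with the slope of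
-- step `n`.
theorem IsHarderNarasimhan.sub_le (h : IsHarderNarasimhan v 𝓕) (U : Submodule F (Fin r → F))
    {n : ℕ} (hn : n ≤ 𝓕.length) :
    v U - v (U ⊓ 𝓕.nth n) ≤ chord v (𝓕.nth n) (𝓕.nth (n + 1)) *
      ((finrank F U : ℝ) - finrank F (U ⊓ 𝓕.nth n : Submodule F (Fin r → F))) := by
  induction hn using Nat.decreasingInduction with
  -- At the end of the filtration nothing of `U` remains, so the value of the degenerate chord is
  -- irrelevant.
  | self => rw [𝓕.nth_length, inf_top_eq, sub_self, sub_self, mul_zero]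
  | of_succ n hn ih =>
    have h1 := h.step_le hv U hn
    have h2 : (0 : ℝ) ≤
        (finrank F U : ℝ) - finrank F (U ⊓ 𝓕.nth (n + 1) : Submodule F (Fin r → F)) :=
      sub_nonneg.2 (finrank_le_cast inf_le_left)
    rcases (Nat.succ_le_of_lt hn).lt_or_eq with hlt | heq
    · have h3 := mul_le_mul_of_nonneg_right (h.chord_lt n hlt).le h2
      linarith
    · have h3 : U ⊓ 𝓕.nth (n + 1) = U := by
        rw [𝓕.nth_eq_top_iff.2 heq.ge, inf_top_eq]
      rw [h3] at h1
      exact h1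

include hv in
-- This complements `sub_le`: each dimension that `U` misses inside `Wₙ` costs at least the smallest
-- slope there.
theorem IsHarderNarasimhan.inf_le (h : IsHarderNarasimhan v 𝓕) (U : Submodule F (Fin r → F))
    {n : ℕ} (hn : n ≤ 𝓕.length) {t : ℝ}
    (ht : ∀ m < n, t ≤ chord v (𝓕.nth m) (𝓕.nth (m + 1))) :
    v (U ⊓ 𝓕.nth n) ≤ v (𝓕.nth n) - t *
      ((finrank F (𝓕.nth n) : ℝ) - finrank F (U ⊓ 𝓕.nth n : Submodule F (Fin r → F))) := by
  induction n with
  | zero => rw [𝓕.nth_zero, inf_bot_eq, sub_self, mul_zero, sub_zero]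
  | succ n ih =>
    have h0 := ih (by omega) fun m hm => ht m (by omega)
    have h1 := h.step_le hv U hn
    have h2 := chord_mul (v := v) (𝓕.nth_lt n.lt_succ_self hn)
    have h3 := finrank_sup_add_inf_cast (U ⊓ 𝓕.nth (n + 1)) (𝓕.nth n)
    have hle : 𝓕.nth n ≤ 𝓕.nth (n + 1) := 𝓕.nth_mono n.le_succ
    have h4 := finrank_le_cast (sup_le (inf_le_right : U ⊓ 𝓕.nth (n + 1) ≤ _) hle)
    rw [inf_assoc, inf_eq_right.2 hle] at h3
    nlinarith [ht n n.lt_succ_self]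

theorem IsHarderNarasimhan.chord_le (h : IsHarderNarasimhan v 𝓕) {m n : ℕ} (hmn : m ≤ n)
    (hn : n < 𝓕.length) :
    chord v (𝓕.nth n) (𝓕.nth (n + 1)) ≤ chord v (𝓕.nth m) (𝓕.nth (m + 1)) := by
  induction n, hmn using Nat.le_induction with
  | base => exact le_rfl
  | succ n hmn ih => exact (h.chord_lt n hn).le.trans (ih (by omega))

include hv in
-- If `dim U` falls into step `j`, `sub_le` bounds the part of `U` beyond `Wⱼ` and `inf_le` the part
-- inside it, both with the slope of step `j`. The bounds add up to the line carrying the polygon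
-- there.
theorem IsHarderNarasimhan.le_filtrationPolygon (hr : 0 < r) (h0 : v ⊥ = 0)
    (h : IsHarderNarasimhan v 𝓕) (U : Submodule F (Fin r → F)) :
    v U ≤ filtrationPolygon v 𝓕 (finrank F U) := by
  have hU : (finrank F U : ℝ) ≤ r := by
    have := Submodule.finrank_le U
    rw [finrank_fin_fun] at this
    exact_mod_cast this
  obtain ⟨j, hj, h1, h2⟩ := exists_step 𝓕 (Nat.cast_nonneg (finrank F U)) hr hU
  rw [filtrationPolygon_eq v 𝓕 hj h1 h2, h0]
  have h3 := h.sub_le hv U hj.le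
  have h4 := h.inf_le hv U hj.le fun m hm => h.chord_le hm.le hj
  linarith

include hv in
-- Thus `Wₙ₊₁` is the largest subspace of maximal slope above `Wₙ`. This characterizes each step by
-- the preceding one and gives uniqueness.
theorem IsHarderNarasimhan.chord_lt_or_le (h : IsHarderNarasimhan v 𝓕) {n : ℕ}
    (hn : n < 𝓕.length) {U : Submodule F (Fin r → F)} (hU : 𝓕.nth n < U) :
    chord v (𝓕.nth n) U < chord v (𝓕.nth n) (𝓕.nth (n + 1)) ∨
      chord v (𝓕.nth n) U ≤ chord v (𝓕.nth n) (𝓕.nth (n + 1)) ∧ U ≤ 𝓕.nth (n + 1) := by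
  by_cases hle : U ≤ 𝓕.nth (n + 1)
  · exact Or.inr ⟨h.semistable n hn U hU hle, hle⟩
  · left
    have hlt : n + 1 < 𝓕.length := by
      by_contra! hge
      exact hle (𝓕.nth_eq_top_iff.2 hge ▸ le_top)
    have h1 := h.step_le hv U hn
    have h2 := h.sub_le hv U hlt.le
    have h3 := h.chord_lt n hlt
    have h4 : (0 : ℝ) <
        (finrank F U : ℝ) - finrank F (U ⊓ 𝓕.nth (n + 1) : Submodule F (Fin r → F)) :=
      sub_pos.2 (finrank_lt_cast (lt_of_le_of_ne inf_le_left fun h => hle (inf_eq_left.1 h)))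
    have h5 := mul_lt_mul_of_pos_right h3 h4
    rw [inf_eq_right.2 hU.le] at h1
    have h6 := sub_pos.2 (finrank_lt_cast hU)
    rw [chord, div_lt_iff₀ h6]
    linarith

include hv in
theorem IsHarderNarasimhan.unique {𝓖 : Filtration F r} (h : IsHarderNarasimhan v 𝓕)
    (h' : IsHarderNarasimhan v 𝓖) : 𝓕 = 𝓖 := by
  refine Filtration.ext_nth fun n => ?_
  induction n with
  | zero => rw [𝓕.nth_zero, 𝓖.nth_zero]
  | succ n ih =>
    by_cases hn : n < 𝓕.length
    · have hn' : n < 𝓖.length := by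
        by_contra! hge
        rw [← 𝓖.nth_eq_top_iff, ← ih, 𝓕.nth_eq_top_iff] at hge
        omega
      have h1 := h.chord_lt_or_le hv hn (U := 𝓖.nth (n + 1)) (ih ▸ 𝓖.nth_lt n.lt_succ_self hn')
      have h2 := h'.chord_lt_or_le hv hn' (U := 𝓕.nth (n + 1)) (ih ▸ 𝓕.nth_lt n.lt_succ_self hn)
      rw [← ih] at h2
      rcases h1 with h1 | ⟨h1, h1'⟩
      · rcases h2 with h2 | ⟨h2, h2'⟩
        · exact absurd h1 h2.asymm
        · exact absurd h2 h1.not_ge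
      · rcases h2 with h2 | ⟨h2, h2'⟩
        · exact absurd h1 h2.not_ge
        · exact le_antisymm h2' h1'
    · rw [not_lt] at hn
      have hn' : 𝓖.length ≤ n := by rwa [← 𝓖.nth_eq_top_iff, ← ih, 𝓕.nth_eq_top_iff]
      rw [𝓕.nth_eq_top_iff.2 (by omega), 𝓖.nth_eq_top_iff.2 (by omega)]

end supermodular

section existence

variable {v : Submodule F (Fin r → F) → ℝ} (hfin : ∀ C, {W | C ≤ v W}.Finite)

include hfin in
-- Only finitely many subspaces have slope at least that of `⊤`; the lexicographic maximum of slope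
-- and dimension among them is the next step of the filtration.
theorem exists_maximal_chord {W : Submodule F (Fin r → F)} (hW : W < ⊤) :
    ∃ M, W < M ∧ ∀ U, W < U → chord v W U < chord v W M ∨
      chord v W U = chord v W M ∧ finrank F U ≤ finrank F M := by
  set T := {U | W < U ∧ chord v W ⊤ ≤ chord v W U}
  have hT : T.Finite := by
    refine (hfin (v W - |chord v W ⊤| * r)).subset fun U ⟨hU, hc⟩ => ?_
    have h1 := chord_mul (v := v) hU
    have h2 := sub_pos.2 (finrank_lt_cast hU)
    have h3 : (finrank F U : ℝ) ≤ r := by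
      have := Submodule.finrank_le U
      rw [finrank_fin_fun] at this
      exact_mod_cast this
    have h4 : (0 : ℝ) ≤ finrank F W := Nat.cast_nonneg _
    have h5 := mul_le_mul_of_nonneg_right hc h2.le
    have h6 := neg_abs_le (chord v W ⊤)
    have h7 := abs_nonneg (chord v W ⊤)
    change v W - |chord v W ⊤| * r ≤ v U
    nlinarith
  obtain ⟨M, hM, hmax⟩ := hT.exists_maximalFor
    (fun U => toLex (chord v W U, finrank F U)) T ⟨⊤, hW, le_rfl⟩
  refine ⟨M, hM.1, fun U hU => ?_⟩
  by_cases hUT : chord v W ⊤ ≤ chord v W U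
  · by_contra hcon
    have hlt : toLex (chord v W M, finrank F M) < toLex (chord v W U, finrank F U) := by
      rw [Prod.Lex.toLex_lt_toLex]
      push Not at hcon
      rcases hcon.1.lt_or_eq with h | h
      · exact Or.inl h
      · exact Or.inr ⟨h, hcon.2 h.symm⟩
    exact absurd (hmax ⟨hU, hUT⟩ hlt.le) (not_le.2 hlt)
  · exact Or.inl ((not_le.1 hUT).trans_le hM.2)

include hfin in
theorem exists_isHarderNarasimhan : ∃ 𝓕 : Filtration F r, IsHarderNarasimhan v 𝓕 := by
  classical
  have hnext : ∀ W : Submodule F (Fin r → F), ∃ M, W < ⊤ → W < M ∧ ∀ U, W < U →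
      chord v W U < chord v W M ∨ chord v W U = chord v W M ∧ finrank F U ≤ finrank F M := by
    intro W
    by_cases hW : W < ⊤
    · obtain ⟨M, hM⟩ := exists_maximal_chord hfin hW
      exact ⟨M, fun _ => hM⟩
    · exact ⟨⊤, fun h => absurd h hW⟩
  choose next hnext using hnext
  set s : ℕ → Submodule F (Fin r → F) := fun n => next^[n] ⊥ with hs
  have hsucc : ∀ n, s (n + 1) = next (s n) := fun n => Function.iterate_succ_apply' _ _ _
  have hex : ∃ n, s n = ⊤ := by
    by_contra! hne
    have hdim : ∀ n, n ≤ finrank F (s n) := by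
      intro n
      induction n with
      | zero => exact Nat.zero_le _
      | succ n ih =>
        have := Submodule.finrank_lt_finrank_of_lt (hnext _ (lt_top_iff_ne_top.2 (hne n))).1
        rw [hsucc]
        omega
    have h1 := hdim (r + 1)
    have h2 := Submodule.finrank_le (s (r + 1))
    rw [finrank_fin_fun] at h2
    omega
  have hlt : ∀ n < Nat.find hex, s n < ⊤ := fun n hn => lt_top_iff_ne_top.2 (Nat.find_min hex hn)
  let 𝓕 : Filtration F r :=
    { length := Nat.find hex
      space := fun i => s i
      strictMono := Fin.strictMono_iff_lt_succ.2 fun i => by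
        rw [Fin.val_succ, Fin.val_castSucc, hsucc]
        exact (hnext _ (hlt i i.2)).1
      space_zero := rfl
      space_last := Nat.find_spec hex }
  have hnth : ∀ n ≤ Nat.find hex, 𝓕.nth n = s n := fun n hn => 𝓕.nth_eq (Nat.lt_succ_of_le hn)
  refine ⟨𝓕, fun n hn U hU hU' => ?_, fun n hn => ?_⟩
  · change n < Nat.find hex at hn
    rw [hnth n hn.le] at hU
    rw [hnth n hn.le, hnth _ hn, hsucc]
    rcases (hnext _ (hlt n hn)).2 U hU with h | h
    · exact h.le
    · exact h.1.le
  · change n + 1 < Nat.find hex at hn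
    rw [hnth n (by omega), hnth (n + 1) hn.le, hnth (n + 2) hn]
    obtain ⟨h1, h2⟩ := hnext _ (hlt n (by omega))
    obtain ⟨h3, -⟩ := hnext _ (hlt (n + 1) hn)
    rw [← hsucc] at h1 h2 h3
    change s (n + 1) < s (n + 2) at h3
    by_contra! hge
    have h4 := chord_mul (v := v) h1
    have h5 := chord_mul (v := v) h3
    have h6 := sub_pos.2 (finrank_lt_cast h1)
    have h7 := sub_pos.2 (finrank_lt_cast h3)
    -- If the slopes failed to decrease, the larger space `s (n + 2)` would contradict the
    -- lexicographic maximality of `s (n + 1)`.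
    have h8 : chord v (s n) (s (n + 1)) ≤ chord v (s n) (s (n + 2)) := by
      conv_rhs => rw [chord]
      rw [le_div_iff₀ (by linarith)]
      nlinarith [mul_le_mul_of_nonneg_right hge h7.le]
    rcases h2 _ (h1.trans h3) with h | h
    · exact absurd h h8.not_gt
    · exact absurd h.2 (not_le.2 (Submodule.finrank_lt_finrank_of_lt h3))

end existence

end HarderNarasimhan

theorem IsConvexNormalizedPolygon.nonneg {r : ℕ} {p : ℝ → ℝ} (hr : 0 < r)
    (hp : IsConvexNormalizedPolygon r p) {x : ℝ} (hx : x ∈ Set.Icc (0 : ℝ) r) : 0 ≤ p x := by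
  have hr' : (0 : ℝ) < r := Nat.cast_pos.2 hr
  have h := hp.concaveOn.2 (Set.left_mem_Icc.2 hr'.le) (Set.right_mem_Icc.2 hr'.le)
    (sub_nonneg.2 ((div_le_one hr').2 hx.2)) (div_nonneg hx.1 hr'.le) (sub_add_cancel _ _)
  rw [hp.map_zero, hp.map_rank] at h
  simpa [div_mul_cancel₀ x hr'.ne'] using h

/-- A concave function lies above its chords. -/
theorem chord_le_of_concaveOn {s : Set ℝ} {p : ℝ → ℝ} (hp : ConcaveOn ℝ s p) {a b x A B : ℝ}
    (ha : a ∈ s) (hb : b ∈ s) (hab : a < b) (hax : a ≤ x) (hxb : x ≤ b) (hA : A ≤ p a)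
    (hB : B ≤ p b) : A + (B - A) / (b - a) * (x - a) ≤ p x := by
  have hba := sub_pos.2 hab
  have hone : (b - x) / (b - a) + (x - a) / (b - a) = 1 := by
    field_simp
    ring
  have h := hp.2 ha hb (div_nonneg (sub_nonneg.2 hxb) hba.le)
    (div_nonneg (sub_nonneg.2 hax) hba.le) hone
  have hx : ((b - x) / (b - a)) • a + ((x - a) / (b - a)) • b = x := by
    simp only [smul_eq_mul]
    field_simp
    ring
  rw [hx, smul_eq_mul, smul_eq_mul] at h
  refine le_trans ?_ h
  have h1 := mul_le_mul_of_nonneg_left hA (div_nonneg (sub_nonneg.2 hxb) hba.le)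
  have h2 := mul_le_mul_of_nonneg_left hB (div_nonneg (sub_nonneg.2 hax) hba.le)
  refine le_trans (le_of_eq ?_) (add_le_add h1 h2)
  field_simp
  ring

theorem finrank_mem_Icc {F : Type*} [Field F] {r : ℕ} (W : Submodule F (Fin r → F)) :
    (finrank F W : ℝ) ∈ Set.Icc (0 : ℝ) r := by
  refine ⟨Nat.cast_nonneg _, ?_⟩
  have := Submodule.finrank_le W
  rw [finrank_fin_fun] at this
  exact_mod_cast this

/-! ### The canonical polygon as a concave hull -/

section Canonical

variable {F : Type*} [Field F] [NumberField F] {r : ℕ}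

theorem slope_eq_chord (g : GL (Fin r) 𝔸[F]) {W W' : Submodule F (Fin r → F)} (h : W < W') :
    slope g W W' = chord (vertex g) W W' + subDegree g ⊤ / r :=
  slope_eq g h

theorem isCanonical_iff {g : GL (Fin r) 𝔸[F]} {𝓕 : Filtration F r} :
    IsCanonical g 𝓕 ↔ IsHarderNarasimhan (vertex g) 𝓕 := by
  have hlt : ∀ n, n < 𝓕.length → 𝓕.nth n < 𝓕.nth (n + 1) := fun n hn => 𝓕.nth_lt n.lt_succ_self hn
  constructor
  · rintro ⟨h1, h2⟩
    refine ⟨fun n hn U hU hU' => ?_, fun n hn => ?_⟩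
    · have h := h1 ⟨n, hn⟩ U
      rw [𝓕.space_castSucc, 𝓕.space_succ] at h
      have h' := h hU hU'
      rw [slope_eq_chord g hU, slope_eq_chord g (hlt n hn)] at h'
      linarith
    · have h := h2 (show (⟨n, by omega⟩ : Fin 𝓕.length) < ⟨n + 1, hn⟩ from Nat.lt_succ_self n)
      simp only [𝓕.space_castSucc, 𝓕.space_succ] at h
      rw [slope_eq_chord g (hlt n (by omega)), slope_eq_chord g (hlt (n + 1) hn)] at h
      linarith
  · intro h
    refine ⟨fun i U hU hU' => ?_, fun i j hij => ?_⟩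
    · rw [𝓕.space_castSucc] at hU ⊢
      rw [𝓕.space_succ] at hU' ⊢
      rw [slope_eq_chord g hU, slope_eq_chord g (hlt i i.2)]
      linarith [h.semistable i i.2 U hU hU']
    · simp only [𝓕.space_castSucc, 𝓕.space_succ]
      rw [slope_eq_chord g (hlt i i.2), slope_eq_chord g (hlt j j.2)]
      have hij' : (i : ℕ) < j := hij
      have h1 := h.chord_lt i (by omega)
      have h2 := h.chord_le (m := i + 1) (n := j) hij j.2
      linarith

theorem existsUnique_isCanonical (g : GL (Fin r) 𝔸[F]) : ∃! 𝓕 : Filtration F r, IsCanonical g 𝓕 := by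
  obtain ⟨𝓕, h⟩ := exists_isHarderNarasimhan (finite_setOf_le_vertex g)
  exact ⟨𝓕, isCanonical_iff.2 h, fun 𝓖 h' =>
    (isCanonical_iff.1 h').unique (vertex_add_vertex_le g) h⟩

theorem polygon_eq_filtrationPolygon (g : GL (Fin r) 𝔸[F]) (𝓕 : Filtration F r) :
    polygon g 𝓕 = filtrationPolygon (vertex g) 𝓕 := by
  ext x
  rw [polygon, filtrationPolygon, Finset.sum_range]
  refine Finset.sum_congr rfl fun i _ => ?_
  rw [𝓕.space_castSucc, 𝓕.space_succ]
  rfl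

theorem polygon_finrank_nth (hr : 0 < r) (g : GL (Fin r) 𝔸[F]) (𝓕 : Filtration F r) {j : ℕ}
    (hj : j ≤ 𝓕.length) : polygon g 𝓕 (finrank F (𝓕.nth j)) = vertex g (𝓕.nth j) := by
  rw [polygon_eq_filtrationPolygon, filtrationPolygon_vertex _ _ hj hr, vertex_bot, sub_zero]

/-- The canonical polygon is the concave hull of the points `(rk Λ^g_W, vertex g W)`. -/
theorem canonicalPolygon_le_iff (hr : 0 < r) {p : ℝ → ℝ} (hp : IsConvexNormalizedPolygon r p)
    (g : GL (Fin r) 𝔸[F]) : (∀ x ∈ Set.Icc (0 : ℝ) r, canonicalPolygon g x ≤ p x) ↔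
      ∀ W : Submodule F (Fin r → F), vertex g W ≤ p (finrank F W) := by
  have hex := (existsUnique_isCanonical g).exists
  rw [canonicalPolygon, dif_pos hex]
  set 𝓕 := hex.choose
  have hF : IsHarderNarasimhan (vertex g) 𝓕 := isCanonical_iff.1 hex.choose_spec
  rw [polygon_eq_filtrationPolygon]
  constructor
  · intro h W
    exact (hF.le_filtrationPolygon (vertex_add_vertex_le g) hr (vertex_bot g) W).trans
      (h _ (finrank_mem_Icc W))
  · intro h x hx
    obtain ⟨j, hj, h1, h2⟩ := exists_step 𝓕 hx.1 hr hx.2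
    rw [filtrationPolygon_eq _ 𝓕 hj h1 h2, vertex_bot, sub_zero]
    exact chord_le_of_concaveOn hp.concaveOn (finrank_mem_Icc _) (finrank_mem_Icc _)
      (finrank_lt_cast (𝓕.nth_lt j.lt_succ_self hj)) h1 h2 (h _) (h _)

end Canonical

/-! ### Alternating sums over chains -/

section Chains

variable {α : Type*} [SemilatticeInf α] [DecidableEq α]

open Classical in
/-- The element that is added to or removed from a chain, in terms of the set of the elements of
the chain that are not below `A`. -/
def togglePoint (A : α) (d : Finset α) : α :=
  if h : ∃ x ∈ d, ∀ y ∈ d, x ≤ y then A ⊓ h.choose else A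

theorem togglePoint_le (A : α) (d : Finset α) : togglePoint A d ≤ A := by
  rw [togglePoint]
  split_ifs
  · exact inf_le_left
  · exact le_rfl

theorem togglePoint_mem {S : Finset α} {A : α} (hA : A ∈ S) (hS : ∀ B ∈ S, A ⊓ B ∈ S)
    {d : Finset α} (hd : d ⊆ S) : togglePoint A d ∈ S := by
  rw [togglePoint]
  split_ifs with h
  · exact hS _ (hd h.choose_spec.1)
  · exact hA

open Classical in
-- Let `x` be the least element of the chain not below `A`. Elements not below `A` are above `x`;
-- elements below `A` are also below `x`, so below `A ⊓ x`. Without such an `x` the whole finite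
-- chain is below `A`.
theorem togglePoint_comparable (A : α) {c : Finset α} (hc : IsChain (· ≤ ·) (c : Set α)) {b : α}
    (hb : b ∈ c) : togglePoint A (c.filter (¬ · ≤ A)) ≤ b ∨
      b ≤ togglePoint A (c.filter (¬ · ≤ A)) := by
  rw [togglePoint]
  split_ifs with h
  · obtain ⟨h1, h2⟩ := h.choose_spec
    set x := h.choose
    rw [Finset.mem_filter] at h1
    by_cases hbA : b ≤ A
    · rcases hc.total h1.1 hb with h3 | h3
      · exact absurd (h3.trans hbA) h1.2
      · exact Or.inr (le_inf hbA h3)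
    · exact Or.inl (inf_le_right.trans (h2 b (Finset.mem_filter.2 ⟨hb, hbA⟩)))
  · right
    by_contra hbA
    obtain ⟨x, hx, hmin⟩ := (c.filter (¬ · ≤ A)).exists_minimal
      ⟨b, Finset.mem_filter.2 ⟨hb, hbA⟩⟩
    refine h ⟨x, hx, fun y hy => ?_⟩
    rcases hc.total (Finset.mem_filter.1 hx).1 (Finset.mem_filter.1 hy).1 with h3 | h3
    · exact h3
    · exact hmin hy h3

open Classical in
/-- The reduced Euler characteristic of a conically contractible finite poset vanishes. -/
theorem sum_chains_eq_zero {S : Finset α} {A : α} (hA : A ∈ S) (hS : ∀ B ∈ S, A ⊓ B ∈ S) :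
    ∑ c ∈ S.powerset.filter (fun c : Finset α => IsChain (· ≤ ·) (c : Set α)), (-1 : ℤ) ^ c.card = 0 := by
  -- The point `e c` is below `A` and depends only on the members of `c` not below `A`. Toggling it
  -- therefore does not change it, and `t` is an involution that reverses signs.
  let e : Finset α → α := fun c => togglePoint A (c.filter (¬ · ≤ A))
  let t : Finset α → Finset α := fun c => if e c ∈ c then c.erase (e c) else insert (e c) c
  have he : ∀ c, e (t c) = e c := by
    intro c
    have hA' : e c ≤ A := togglePoint_le _ _
    have h : (t c).filter (¬ · ≤ A) = c.filter (¬ · ≤ A) := by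
      ext x
      simp only [Finset.mem_filter, t]
      refine and_congr_left fun hx => ?_
      have hne : x ≠ e c := fun h => hx (h ▸ hA')
      split_ifs <;> simp [hne]
    exact congrArg (togglePoint A) h
  refine Finset.sum_involution (fun c _ => t c) ?_ ?_ ?_ ?_
  · intro c _
    simp only [t]
    split_ifs with h
    · rw [← Finset.card_erase_add_one h, pow_succ]
      ring
    · rw [Finset.card_insert_of_notMem h, pow_succ]
      ring
  · intro c _ _ heq
    simp only [t] at heq
    split_ifs at heq with h
    · exact Finset.notMem_erase (e c) c (heq.symm ▸ h)
    · exact h (Finset.insert_eq_self.1 heq)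
  · intro c hc
    rw [Finset.mem_filter, Finset.mem_powerset] at hc ⊢
    simp only [t]
    split_ifs with h
    · exact ⟨(Finset.erase_subset _ _).trans hc.1,
        hc.2.mono (Finset.coe_subset.2 (Finset.erase_subset _ _))⟩
    · refine ⟨Finset.insert_subset
        (togglePoint_mem hA hS ((Finset.filter_subset _ _).trans hc.1)) hc.1, ?_⟩
      rw [Finset.coe_insert]
      exact hc.2.insert fun b hb _ => togglePoint_comparable A hc.2 hb
  · intro c _
    change (if e (t c) ∈ t c then (t c).erase (e (t c)) else insert (e (t c)) (t c)) = c
    rw [he]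
    by_cases h : e c ∈ c
    · have ht : t c = c.erase (e c) := if_pos h
      rw [ht, if_neg (Finset.notMem_erase _ _), Finset.insert_erase h]
    · have ht : t c = insert (e c) c := if_neg h
      rw [ht, if_pos (Finset.mem_insert_self _ _), Finset.erase_insert h]

end Chains

/-! ### Subspaces above the polygon `p` -/

section Destabilizing

variable {F : Type*} [Field F] [NumberField F] {r : ℕ}

/-- Concavity and the zeros at `0` and `r` make `p` nonnegative, so these vertices are nonnegative.
-/
theorem finite_setOf_lt_vertex (hr : 0 < r) {p : ℝ → ℝ} (hp : IsConvexNormalizedPolygon r p)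
    (g : GL (Fin r) 𝔸[F]) :
    {W : Submodule F (Fin r → F) | p (finrank F W) < vertex g W}.Finite :=
  (finite_setOf_le_vertex g 0).subset fun W hW =>
    (hp.nonneg hr (finrank_mem_Icc W)).trans hW.le

/-- The subspaces at which the polygon of the lattice exceeds `p`. -/
def destabilizing (hr : 0 < r) {p : ℝ → ℝ} (hp : IsConvexNormalizedPolygon r p)
    (g : GL (Fin r) 𝔸[F]) : Finset (Submodule F (Fin r → F)) :=
  (finite_setOf_lt_vertex hr hp g).toFinset

theorem mem_destabilizing {hr : 0 < r} {p : ℝ → ℝ} {hp : IsConvexNormalizedPolygon r p}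
    {g : GL (Fin r) 𝔸[F]} {W : Submodule F (Fin r → F)} :
    W ∈ destabilizing hr hp g ↔ p (finrank F W) < vertex g W :=
  Set.Finite.mem_toFinset _

/-- At `b` and `c` the function lies above its chord over `[a, d]`, and the chord takes equal sums
on pairs with equal sums. -/
theorem add_le_add_of_concaveOn {p : ℝ → ℝ} {s : Set ℝ} (hp : ConcaveOn ℝ s p) {a b c d : ℝ}
    (ha : a ∈ s) (hd : d ∈ s) (hab : a ≤ b) (hbd : b ≤ d) (hsum : a + d = b + c) :
    p a + p d ≤ p b + p c := by
  rcases (hab.trans hbd).eq_or_lt with h | h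
  · have hb : b = a := le_antisymm (h ▸ hbd) hab
    have hc : c = d := by linarith
    rw [hb, hc]
  · have h1 := chord_le_of_concaveOn hp ha hd h hab hbd le_rfl le_rfl
    have h2 := chord_le_of_concaveOn hp ha hd h (x := c) (by linarith) (by linarith) le_rfl le_rfl
    have h3 : p d - p a = (p d - p a) / (d - a) * (b - a) + (p d - p a) / (d - a) * (c - a) := by
      rw [← mul_add, show b - a + (c - a) = d - a by linarith,
        div_mul_cancel₀ _ (sub_pos.2 h).ne']
    linarith

open Classical in
theorem ind_canonicalPolygon_le (hr : 0 < r) {p : ℝ → ℝ} (hp : IsConvexNormalizedPolygon r p)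
    (g : GL (Fin r) 𝔸[F]) : ind (∀ x ∈ Set.Icc (0 : ℝ) r, canonicalPolygon g x ≤ p x) =
      ∑ c ∈ (destabilizing hr hp g).powerset.filter
        (fun c : Finset (Submodule F (Fin r → F)) => IsChain (· ≤ ·) (c : Set (Submodule F (Fin r → F)))), (-1 : ℤ) ^ c.card := by
  rw [canonicalPolygon_le_iff hr hp g]
  rcases (destabilizing hr hp g).eq_empty_or_nonempty with he | hne
  · rw [ind, if_pos]
    · rw [he, Finset.powerset_empty, Finset.filter_singleton, if_pos (by simp),
        Finset.sum_singleton, Finset.card_empty, pow_zero]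
    · intro W
      by_contra! hW
      have := mem_destabilizing (hr := hr) (hp := hp).2 hW
      rw [he] at this
      exact Finset.notMem_empty _ this
  · rw [ind, if_neg]
    -- Write `e W = vertex g W - p (dim W)`. Then `e (A ⊓ B) ≥ e A + e B - e (A ⊔ B) ≥ e B > 0`, as
    -- `e A` is maximal; if `A ⊔ B` is not destabilizing, `e (A ⊔ B) ≤ 0 < e A`.
    · obtain ⟨A, hA, hmax⟩ := (destabilizing hr hp g).exists_max_image
        (fun W => vertex g W - p (finrank F W)) hne
      refine (sum_chains_eq_zero hA fun B hB => ?_).symm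
      have h1 := vertex_add_vertex_le g A B
      have h2 := add_le_add_of_concaveOn hp.concaveOn (finrank_mem_Icc (A ⊓ B))
        (finrank_mem_Icc (A ⊔ B)) (finrank_le_cast (inf_le_left : A ⊓ B ≤ A))
        (finrank_le_cast le_sup_left) (by rw [add_comm]; exact finrank_sup_add_inf_cast A B)
      have h3 : vertex g (A ⊔ B) - p (finrank F (A ⊔ B : Submodule F (Fin r → F))) ≤
          vertex g A - p (finrank F A) := by
        by_cases hAB : A ⊔ B ∈ destabilizing hr hp g
        · exact hmax _ hAB
        · have h4 := not_lt.1 (mt mem_destabilizing.2 hAB)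
          have h5 := mem_destabilizing.1 hA
          linarith
      rw [mem_destabilizing] at hB ⊢
      linarith
    · obtain ⟨W, hW⟩ := hne
      intro h
      exact absurd (h W) (not_le.2 (mem_destabilizing.1 hW))

theorem finrank_mem_Ioo_of_mem_destabilizing {hr : 0 < r} {p : ℝ → ℝ}
    {hp : IsConvexNormalizedPolygon r p} {g : GL (Fin r) 𝔸[F]} {W : Submodule F (Fin r → F)}
    (hW : W ∈ destabilizing hr hp g) : finrank F W ∈ Finset.Ioo 0 r := by
  rw [mem_destabilizing] at hW
  rw [Finset.mem_Ioo]
  constructor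
  · refine Nat.pos_of_ne_zero fun h => ?_
    rw [Submodule.finrank_eq_zero] at h
    rw [h, vertex_bot, finrank_bot, Nat.cast_zero, hp.map_zero] at hW
    exact lt_irrefl _ hW
  · have hle := Submodule.finrank_le W
    rw [finrank_fin_fun] at hle
    refine lt_of_le_of_ne hle fun h => ?_
    have htop : W = ⊤ := Submodule.eq_top_of_finrank_eq (h.trans (finrank_fin_fun F).symm)
    rw [h, hp.map_rank, htop, vertex_top hr] at hW
    exact lt_irrefl _ hW

end Destabilizing

/-! ### Flags and cosets of parabolic subgroups -/

section AdaptedBases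

theorem finrank_coordSpace (F : Type*) [Field F] {r k : ℕ} (hk : k ≤ r) :
    finrank F (coordSpace F r k) = k := by
  have hlow : ∀ m ≤ r, m ≤ finrank F (coordSpace F r m) := by
    intro m hm
    induction m with
    | zero => exact Nat.zero_le _
    | succ m ih =>
      have h := Submodule.finrank_lt_finrank_of_lt (coordSpace_lt F (show m < m + 1 by omega) hm)
      have := ih (by omega)
      omega
  have hup : ∀ m, k + m ≤ r →
      finrank F (coordSpace F r k) + m ≤ finrank F (coordSpace F r (k + m)) := by
    intro m hm
    induction m with
    | zero => exact le_rfl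
    | succ m ih =>
      have h := Submodule.finrank_lt_finrank_of_lt (coordSpace_lt F (show k + m < k + m + 1 by omega) hm)
      have := ih (by omega)
      rw [← add_assoc]
      exact Nat.succ_le_of_lt (lt_of_le_of_lt this h)
  have h1 := hlow k hk
  have h2 := hup (r - k) (by omega)
  have h3 := Submodule.finrank_le (coordSpace F r (k + (r - k)))
  rw [finrank_fin_fun] at h3
  omega

variable (R : Type*) {F : Type*} [CommRing R] [IsDomain R] [IsPrincipalIdealRing R] [Field F]
  [Algebra R F] [IsFractionRing R F] {r : ℕ}

/-- The embedding `R ^ r → F ^ r`. -/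
def coordInclusion (F : Type*) [Field F] [Algebra R F] (r : ℕ) : (Fin r → R) →ₗ[R] (Fin r → F) :=
  (Algebra.linearMap R F).compLeft (Fin r)

theorem coordInclusion_injective : Function.Injective (coordInclusion R F r) := fun x y h => by
  ext i
  exact IsFractionRing.injective R F (congrFun h i)

/-- The intersection of a subspace of `F ^ r` with `R ^ r`. -/
def integralPart (W : Submodule F (Fin r → F)) : Submodule R (Fin r → R) :=
  (W.restrictScalars R).comap (coordInclusion R F r)

theorem mem_integralPart {W : Submodule F (Fin r → F)} {x : Fin r → R} :
    x ∈ integralPart R W ↔ coordInclusion R F r x ∈ W := Iff.rfl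

theorem span_integralPart (W : Submodule F (Fin r → F)) :
    Submodule.span F (coordInclusion R F r '' integralPart R W) = W := by
  refine le_antisymm ?_ fun x hx => ?_
  · rw [Submodule.span_le]
    rintro _ ⟨y, hy, rfl⟩
    exact hy
  · obtain ⟨d, hd⟩ := IsLocalization.exist_integer_multiples (nonZeroDivisors R) Finset.univ x
    choose y hy using fun i => hd i (Finset.mem_univ i)
    have hy' : coordInclusion R F r y = (d : R) • x := by
      ext i
      exact hy i
    have hd0 : algebraMap R F d ≠ 0 :=
      IsFractionRing.to_map_ne_zero_of_mem_nonZeroDivisors d.2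
    have hmem : algebraMap R F d • x ∈ Submodule.span F (coordInclusion R F r '' integralPart R W) := by
      rw [algebraMap_smul, ← hy']
      refine Submodule.subset_span ⟨y, ?_, rfl⟩
      change coordInclusion R F r y ∈ W
      rw [hy', ← algebraMap_smul F]
      exact W.smul_mem _ hx
    exact (Submodule.smul_mem_iff _ hd0).1 hmem

theorem finrank_integralPart (W : Submodule F (Fin r → F)) :
    finrank R (integralPart R W) = finrank F W := by
  let b := Module.finBasis R (integralPart R W)
  have h1 : LinearIndependent R fun i => coordInclusion R F r (b i) :=
    b.linearIndependent.map' ((coordInclusion R F r).comp (integralPart R W).subtype)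
      (LinearMap.ker_eq_bot.2 ((coordInclusion_injective R).comp Subtype.val_injective))
  have h2 : LinearIndependent F fun i => coordInclusion R F r (b i) :=
    (LinearIndependent.iff_fractionRing R F).1 h1
  have h3 : Submodule.span F (Set.range fun i => coordInclusion R F r (b i)) = W := by
    have h4 : Submodule.span R (Set.range fun i => coordInclusion R F r (b i)) =
        (integralPart R W).map (coordInclusion R F r) := by
      have h := congrArg
        (Submodule.map ((coordInclusion R F r).comp (integralPart R W).subtype)) b.span_eq
      rw [Submodule.map_span, ← Set.range_comp, Submodule.map_top, LinearMap.range_comp,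
        Submodule.range_subtype] at h
      exact h
    rw [← Submodule.span_span_of_tower R F, h4]
    exact span_integralPart R W
  conv_rhs => rw [← h3]
  rw [finrank_span_eq_card h2, Fintype.card_fin]

/-- The quotient of the integral parts embeds into `F ^ r / W`, so it is torsion free, hence free
over the principal ideal domain; lifts of a basis serve as `c`. -/
theorem exists_integralPart_eq_sup {W W' : Submodule F (Fin r → F)} (h : W ≤ W') :
    ∃ c : Fin (finrank F W' - finrank F W) → (Fin r → R),
      integralPart R W' = integralPart R W ⊔ Submodule.span R (Set.range c) := by
  let f : integralPart R W' →ₗ[R] ((Fin r → F) ⧸ W) :=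
    (W.mkQ.restrictScalars R).comp ((coordInclusion R F r).comp (integralPart R W').subtype)
  have hker : ∀ x, f x = 0 ↔ (x : Fin r → R) ∈ integralPart R W := fun x =>
    Submodule.Quotient.mk_eq_zero W
  have hle : integralPart R W ≤ integralPart R W' := fun x hx => h hx
  have : Module.IsTorsionFree R ((Fin r → F) ⧸ W) := .of_smul_eq_zero fun a x hax => by
    rw [← algebraMap_smul F, smul_eq_zero] at hax
    exact hax.imp_left fun h => IsFractionRing.injective R F (h.trans (map_zero _).symm)
  have : Module.Free R (LinearMap.range f) := inferInstance
  have hrank : finrank R (LinearMap.range f) = finrank F W' - finrank F W := by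
    have h1 := Submodule.finrank_quotient_add_finrank (LinearMap.ker f)
    have h2 : finrank R (LinearMap.ker f) = finrank R (integralPart R W) := by
      have hmap : (LinearMap.ker f).map (integralPart R W').subtype = integralPart R W := by
        ext x
        constructor
        · rintro ⟨y, hy, rfl⟩
          exact (hker y).1 hy
        · intro hx
          exact ⟨⟨x, hle hx⟩, (hker _).2 hx, rfl⟩
      rw [← hmap]
      exact (Submodule.equivMapOfInjective _ Subtype.val_injective _).finrank_eq
    rw [h2, f.quotKerEquivRange.finrank_eq, finrank_integralPart, finrank_integralPart] at h1
    omega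
  let b := Module.finBasisOfFinrankEq R (LinearMap.range f) hrank
  choose c hc using fun i => (b i).2
  refine ⟨fun i => c i, le_antisymm (fun x hx => ?_) (sup_le hle ?_)⟩
  · obtain ⟨a, ha⟩ : ∃ a : Fin (finrank F W' - finrank F W) → R, ∑ i, a i • f (c i) = f ⟨x, hx⟩ := by
      refine ⟨fun i => b.repr ⟨f ⟨x, hx⟩, LinearMap.mem_range_self _ _⟩ i, ?_⟩
      have h1 := congrArg Subtype.val
        (b.sum_repr ⟨f ⟨x, hx⟩, LinearMap.mem_range_self _ _⟩)
      rw [Submodule.coe_sum] at h1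
      simpa [hc] using h1
    have h1 : (⟨x, hx⟩ - ∑ i, a i • c i : integralPart R W').1 ∈ integralPart R W := by
      rw [← hker, map_sub, map_sum, ← ha]
      simp
    have h2 : (∑ i, a i • (c i : Fin r → R)) ∈
        Submodule.span R (Set.range fun i => (c i : Fin r → R)) :=
      sum_mem fun i _ => Submodule.smul_mem _ _ (Submodule.subset_span ⟨i, rfl⟩)
    have h3 := Submodule.add_mem_sup h1 h2
    simpa using h3
  · rw [Submodule.span_le]
    rintro _ ⟨i, rfl⟩
    exact (c i).2

theorem exists_adapted_sequence {W : ℕ → Submodule F (Fin r → F)} (hW : Monotone W)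
    (hW0 : W 0 = ⊥) (m : ℕ) : ∃ b : ℕ → (Fin r → R), ∀ i ≤ m,
      Submodule.span R (b '' {n | n < finrank F (W i)}) = integralPart R (W i) := by
  induction m with
  | zero =>
    refine ⟨fun _ => 0, fun i hi => ?_⟩
    obtain rfl : i = 0 := by omega
    rw [hW0, finrank_bot]
    simp only [not_lt_zero, Set.ofPred_false, Set.image_empty, Submodule.span_empty]
    refine ((Submodule.eq_bot_iff _).2 fun x hx => ?_).symm
    rw [mem_integralPart, Submodule.mem_bot] at hx
    exact coordInclusion_injective R (hx.trans (map_zero _).symm)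
  | succ m ih =>
    obtain ⟨b, hb⟩ := ih
    obtain ⟨c, hc⟩ := exists_integralPart_eq_sup R (hW (show m ≤ m + 1 by omega))
    have hlast := Submodule.finrank_mono (hW (show m ≤ m + 1 by omega))
    -- The old vectors are kept, the lifts `c` fill the next positions, and the value 0 beyond is a
    -- default.
    set b' : ℕ → (Fin r → R) := fun n => if n < finrank F (W m) then b n else
      if h : n - finrank F (W m) < finrank F (W (m + 1)) - finrank F (W m) then c ⟨_, h⟩ else 0
    have hold : ∀ i ≤ m, b' '' {n | n < finrank F (W i)} = b '' {n | n < finrank F (W i)} := by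
      intro i hi
      refine Set.image_congr fun n hn => ?_
      exact if_pos (lt_of_lt_of_le hn (Submodule.finrank_mono (hW hi)))
    refine ⟨b', fun i hi => ?_⟩
    rcases hi.lt_or_eq with hi | rfl
    · rw [hold i (by omega), hb i (by omega)]
    · have hsplit : {n | n < finrank F (W (m + 1))} = {n | n < finrank F (W m)} ∪
          Set.range fun j : Fin (finrank F (W (m + 1)) - finrank F (W m)) =>
            finrank F (W m) + (j : ℕ) := by
        ext n
        simp only [Set.mem_ofPred_eq, Set.mem_union, Set.mem_range]
        constructor
        · intro hn
          by_cases hn' : n < finrank F (W m)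
          · exact Or.inl hn'
          · exact Or.inr ⟨⟨n - finrank F (W m), by omega⟩, by simp; omega⟩
        · rintro (hn | ⟨j, rfl⟩)
          · omega
          · omega
      rw [hsplit, Set.image_union, Submodule.span_union, hold m le_rfl, hb m le_rfl, hc,
        ← Set.range_comp]
      congr 2
      ext j
      simp [b']

/-- The columns of `B` are the adapted sequence. It generates `R ^ r` because the last space is `⊤`,
so `B` is surjective and hence invertible over `R`, not only over `F`. -/
theorem exists_matrix_map_coordSpace {W : ℕ → Submodule F (Fin r → F)} (hW : Monotone W)
    (hW0 : W 0 = ⊥) {m : ℕ} (hm : W m = ⊤) : ∃ B : GL (Fin r) R, ∀ i ≤ m,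
      (coordSpace F r (finrank F (W i))).map
        (Matrix.GeneralLinearGroup.map (algebraMap R F) B : Matrix (Fin r) (Fin r) F).mulVecLin =
          W i := by
  obtain ⟨b, hb⟩ := exists_adapted_sequence R hW hW0 m
  let M : Matrix (Fin r) (Fin r) R := Matrix.of fun i j => b j i
  have hM : ∀ x, M.mulVec x = ∑ j, x j • b j := fun x => by
    ext i
    simp [M, Matrix.mulVec, dotProduct, mul_comm]
  have hsurj : Function.Surjective M.mulVec := by
    intro y
    have hy : y ∈ Submodule.span R (Set.range fun j : Fin r => b j) := by
      have h1 := hb m le_rfl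
      have h2 : b '' {n | n < r} = Set.range fun j : Fin r => b j := by
        ext z
        constructor
        · rintro ⟨n, hn, rfl⟩
          exact ⟨⟨n, hn⟩, rfl⟩
        · rintro ⟨j, rfl⟩
          exact ⟨j, j.2, rfl⟩
      rw [hm, finrank_top, finrank_fin_fun, h2] at h1
      rw [h1]
      exact Submodule.mem_top
    obtain ⟨x, hx⟩ := (Submodule.mem_span_range_iff_exists_fun R).1 hy
    exact ⟨x, (hM x).trans hx⟩
  have hunit : IsUnit M := Matrix.mulVec_surjective_iff_isUnit.1 hsurj
  refine ⟨hunit.unit, fun i hi => ?_⟩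
  set B : Matrix (Fin r) (Fin r) F :=
    (Matrix.GeneralLinearGroup.map (algebraMap R F) hunit.unit : Matrix (Fin r) (Fin r) F)
  have hinj : Function.Injective B.mulVecLin :=
    Matrix.mulVec_injective_of_isUnit (Units.isUnit _)
  have hk : finrank F (W i) ≤ r := by
    have := Submodule.finrank_le (W i)
    rwa [finrank_fin_fun] at this
  refine Submodule.eq_of_le_of_finrank_eq ?_ ?_
  · rintro _ ⟨x, hx, rfl⟩
    have hB : B.mulVecLin x = ∑ j, x j • coordInclusion R F r (b j) := by
      ext a
      simp only [Matrix.mulVecLin_apply, Matrix.mulVec, dotProduct, Finset.sum_apply,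
        Pi.smul_apply, smul_eq_mul]
      refine Finset.sum_congr rfl fun j _ => ?_
      rw [mul_comm]
      rfl
    rw [hB]
    refine sum_mem fun j _ => ?_
    by_cases hj : (j : ℕ) < finrank F (W i)
    · refine (W i).smul_mem _ ?_
      rw [← mem_integralPart R, ← hb i hi]
      exact Submodule.subset_span ⟨j, hj, rfl⟩
    · rw [hx j (not_lt.1 hj), zero_smul]
      exact zero_mem _
  · rw [(Submodule.equivMapOfInjective _ hinj _).symm.finrank_eq, finrank_coordSpace F hk]

end AdaptedBases

/-! ### Compositions of `r` as subsets of the open interval from `0` to `r` -/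

section Compositions

/-- The numbers `r₁ < ⋯ < rₙ₋₁` strictly between `0` and `r` attached to `r = d₁ + ⋯ + dₙ`. -/
def innerSizes {r : ℕ} (c : Composition r) : Finset ℕ :=
  (Finset.Ico 1 c.length).image c.sizeUpTo

theorem sizeUpTo_lt_sizeUpTo {r : ℕ} (c : Composition r) {i j : ℕ} (hij : i < j)
    (hj : j ≤ c.length) : c.sizeUpTo i < c.sizeUpTo j :=
  (c.sizeUpTo_strict_mono (by omega)).trans_le (c.monotone_sizeUpTo hij)

theorem sizeUpTo_injOn {r : ℕ} (c : Composition r) {i j : ℕ} (hi : i ≤ c.length)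
    (hj : j ≤ c.length) (h : c.sizeUpTo i = c.sizeUpTo j) : i = j := by
  rcases lt_trichotomy i j with hlt | heq | hlt
  · exact absurd h (sizeUpTo_lt_sizeUpTo c hlt hj).ne
  · exact heq
  · exact absurd h (sizeUpTo_lt_sizeUpTo c hlt hi).ne'

theorem card_innerSizes {r : ℕ} (c : Composition r) : (innerSizes c).card = c.length - 1 := by
  rw [innerSizes, Finset.card_image_of_injOn, Nat.card_Ico]
  intro i hi j hj h
  rw [Finset.coe_Ico, Set.mem_Ico] at hi hj
  exact sizeUpTo_injOn c hi.2.le hj.2.le h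

theorem length_pos {r : ℕ} (hr : 0 < r) (c : Composition r) : 0 < c.length :=
  c.length_pos_of_pos hr

theorem mem_boundaries_iff {r : ℕ} (hr : 0 < r) (c : Composition r) (i : Fin (r + 1)) :
    i ∈ c.boundaries ↔ (i : ℕ) ∈ insert 0 (insert r (innerSizes c)) := by
  have hlen := length_pos hr c
  simp only [Composition.boundaries, Finset.mem_map, Finset.mem_univ, true_and,
    Finset.mem_insert, innerSizes, Finset.mem_image, Finset.mem_Ico]
  constructor
  · rintro ⟨j, rfl⟩
    change c.sizeUpTo j = 0 ∨ c.sizeUpTo j = r ∨ ∃ a, _ ∧ c.sizeUpTo a = c.sizeUpTo j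
    rcases Nat.eq_zero_or_pos (j : ℕ) with h | h
    · left
      rw [h, c.sizeUpTo_zero]
    · right
      rcases (Nat.lt_succ_iff.1 j.2).lt_or_eq with h' | h'
      · exact Or.inr ⟨j, ⟨h, h'⟩, rfl⟩
      · left
        rw [h', c.sizeUpTo_length]
  · have key : ∀ a (ha : a < c.length + 1), c.sizeUpTo a = i →
        ∃ j : Fin (c.length + 1), c.boundary j = i := fun a ha h =>
      ⟨⟨a, ha⟩, Fin.ext h⟩
    rintro (h | h | ⟨a, ha, h⟩)
    · exact key 0 (by omega) (by rw [c.sizeUpTo_zero, h])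
    · exact key c.length (by omega) (by rw [c.sizeUpTo_length, h])
    · exact key a (by omega) h

theorem innerSizes_subset {r : ℕ} (c : Composition r) : innerSizes c ⊆ Finset.Ioo 0 r := by
  intro x hx
  obtain ⟨i, hi, rfl⟩ := Finset.mem_image.1 hx
  rw [Finset.mem_Ico] at hi
  rw [Finset.mem_Ioo]
  have h1 := sizeUpTo_lt_sizeUpTo c (i := 0) hi.1 hi.2.le
  have h2 := sizeUpTo_lt_sizeUpTo c hi.2 le_rfl
  rw [c.sizeUpTo_zero] at h1
  rw [c.sizeUpTo_length] at h2
  exact ⟨h1, h2⟩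

theorem existsUnique_innerSizes_eq {r : ℕ} (hr : 0 < r) {D : Finset ℕ}
    (hD : D ⊆ Finset.Ioo 0 r) : ∃! c : Composition r, innerSizes c = D := by
  let C : CompositionAsSet r :=
    ⟨Finset.univ.filter fun i : Fin (r + 1) => (i : ℕ) ∈ insert 0 (insert r D), by simp, by simp⟩
  have hC : ∀ x, x ∈ innerSizes C.toComposition ↔ x ∈ D := by
    intro x
    by_cases hx : x ∈ Finset.Ioo 0 r
    · rw [Finset.mem_Ioo] at hx
      have h1 := mem_boundaries_iff hr C.toComposition ⟨x, by omega⟩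
      have h2 : (⟨x, by omega⟩ : Fin (r + 1)) ∈ C.boundaries ↔ x ∈ insert 0 (insert r D) := by
        simp [C]
      rw [C.toComposition_boundaries, h2] at h1
      simpa only [Finset.mem_insert, hx.1.ne', hx.2.ne, false_or] using h1.symm
    · exact iff_of_false (fun h => hx (innerSizes_subset _ h)) fun h => hx (hD h)
  refine ⟨C.toComposition, Finset.ext hC, fun c hc => ?_⟩
  refine (compositionEquiv r).injective (CompositionAsSet.ext ?_)
  change c.boundaries = C.toComposition.boundaries
  ext i
  rw [mem_boundaries_iff hr, mem_boundaries_iff hr, hc, Finset.ext hC]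

end Compositions

section Flags

variable {R : Type*} (F : Type*) [CommRing R] [IsDomain R] [IsPrincipalIdealRing R] [Field F]
  [Algebra R F] [IsFractionRing R F] {r : ℕ}

/-- The subspace `γ⁻¹ F ^ k`. -/
def flagSpace (γ : GL (Fin r) R) (k : ℕ) : Submodule F (Fin r → F) :=
  (coordSpace F r k).comap
    (Matrix.GeneralLinearGroup.map (algebraMap R F) γ : Matrix (Fin r) (Fin r) F).mulVecLin

theorem flagSpace_mono (γ : GL (Fin r) R) : Monotone (flagSpace F γ) := fun _ _ h =>
  Submodule.comap_mono (coordSpace_mono F r h)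

variable {F}

theorem mulVecLin_bijective (γ : GL (Fin r) F) :
    Function.Bijective (γ : Matrix (Fin r) (Fin r) F).mulVecLin := by
  have h : Function.Injective (γ : Matrix (Fin r) (Fin r) F).mulVecLin :=
    Matrix.mulVec_injective_of_isUnit γ.isUnit
  exact ⟨h, LinearMap.injective_iff_surjective.1 h⟩

theorem map_flagSpace (γ : GL (Fin r) R) (k : ℕ) :
    (flagSpace F γ k).map
    (Matrix.GeneralLinearGroup.map (algebraMap R F) γ : Matrix (Fin r) (Fin r) F).mulVecLin =
      coordSpace F r k :=
  Submodule.map_comap_eq_of_surjective (mulVecLin_bijective _).2 _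

theorem finrank_flagSpace (γ : GL (Fin r) R) {k : ℕ} (hk : k ≤ r) :
    finrank F (flagSpace F γ k) = k := by
  have h := (Submodule.equivMapOfInjective _ (mulVecLin_bijective
    (Matrix.GeneralLinearGroup.map (algebraMap R F) γ)).1 (flagSpace F γ k)).finrank_eq
  rwa [map_flagSpace, finrank_coordSpace F hk] at h

theorem flagSpace_mul (π γ : GL (Fin r) R) (k : ℕ) : flagSpace F (π * γ) k =
    (flagSpace F π k).comap
      (Matrix.GeneralLinearGroup.map (algebraMap R F) γ : Matrix (Fin r) (Fin r) F).mulVecLin := by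
  rw [flagSpace, flagSpace, ← Submodule.comap_comp, ← Matrix.mulVecLin_mul, map_mul, Units.val_mul]

theorem map_mem_stdParabolic {c : Composition r} {π : GL (Fin r) R} :
    Matrix.GeneralLinearGroup.map (algebraMap R F) π ∈ stdParabolic F c ↔ π ∈ stdParabolic R c := by
  constructor
  · intro h i j hij
    exact IsFractionRing.injective R F ((h hij).trans (map_zero _).symm)
  · intro h i j hij
    exact (congrArg (algebraMap R F) (h hij)).trans (map_zero _)

theorem flagSpace_of_mem_stdParabolic {c : Composition r} {π : GL (Fin r) R}
    (hπ : π ∈ stdParabolic R c) (i : ℕ) :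
    flagSpace F π (c.sizeUpTo i) = coordSpace F r (c.sizeUpTo i) := by
  have h := map_mem_stdParabolic (F := F).2 hπ
  refine le_antisymm (fun x hx => ?_) fun x hx => coordSpace_of_blockTriangular h hx
  have h1 := coordSpace_of_blockTriangular (inv_mem h) hx
  rwa [Matrix.mulVecLin_apply, Matrix.mulVec_mulVec, ← Units.val_mul, inv_mul_cancel,
    Units.val_one, Matrix.one_mulVec] at h1

theorem flagSpace_eq_of_rightRel {c : Composition r} {γ γ' : GL (Fin r) R}
    (h : (QuotientGroup.rightRel (stdParabolic R c)).r γ γ') (i : ℕ) :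
    flagSpace F γ (c.sizeUpTo i) = flagSpace F γ' (c.sizeUpTo i) := by
  have h1 : γ' * γ⁻¹ ∈ stdParabolic R c := QuotientGroup.rightRel_apply.1 h
  have h2 := flagSpace_mul (F := F) (γ' * γ⁻¹) γ (c.sizeUpTo i)
  rw [inv_mul_cancel_right, flagSpace_of_mem_stdParabolic h1] at h2
  exact h2.symm

/-- Equality of the flags means that `γ' γ⁻¹` stabilizes each `F ^ k` of the standard flag. Applied
to `e_j`, with `k` the end of the block of `j`, this kills the entries below that block. -/
theorem rightRel_of_flagSpace_eq {c : Composition r} {γ γ' : GL (Fin r) R}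
    (h : ∀ i ∈ Finset.Ico 1 c.length,
      flagSpace F γ (c.sizeUpTo i) = flagSpace F γ' (c.sizeUpTo i)) :
    (QuotientGroup.rightRel (stdParabolic R c)).r γ γ' := by
  refine QuotientGroup.rightRel_apply.2 (map_mem_stdParabolic (F := F).1 fun i j hij => ?_)
  have hij' : (c.index j : ℕ) < c.index i := hij
  have hk := h (c.index j + 1) (Finset.mem_Ico.2 ⟨by omega, by have := (c.index i).2; omega⟩)
  set k := c.sizeUpTo (c.index j + 1)
  have hik : k ≤ i := (c.monotone_sizeUpTo hij').trans (c.sizeUpTo_index_le i)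
  have hjk : (j : ℕ) < k := c.lt_sizeUpTo_index_succ j
  have he : (Pi.single j 1 : Fin r → F) ∈ (flagSpace F γ' k).comap
      (Matrix.GeneralLinearGroup.map (algebraMap R F) γ⁻¹ :
        Matrix (Fin r) (Fin r) F).mulVecLin := by
    rw [← hk, ← flagSpace_mul, mul_inv_cancel]
    intro a ha
    rw [map_one, Units.val_one, Matrix.mulVecLin_one]
    refine Pi.single_eq_of_ne ?_ _
    rintro rfl
    omega
  rw [← flagSpace_mul] at he
  have h1 := he i hik
  rwa [Matrix.mulVecLin_apply, Matrix.mulVec_single_one] at h1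

/-- The set of the proper nonzero subspaces of the flag attached to a coset. -/
def flagSet [DecidableEq (Submodule F (Fin r → F))] (c : Composition r) (γ : GL (Fin r) R) :
    Finset (Submodule F (Fin r → F)) :=
  (Finset.Ico 1 c.length).image fun i => flagSpace F γ (c.sizeUpTo i)

theorem finrank_injOn_of_isChain {T : Set (Submodule F (Fin r → F))} (hT : IsChain (· ≤ ·) T) :
    Set.InjOn (fun W : Submodule F (Fin r → F) => finrank F W) T := by
  intro A hA B hB h
  rcases hT.total hA hB with hle | hle
  · exact Submodule.eq_of_le_of_finrank_eq hle h
  · exact (Submodule.eq_of_le_of_finrank_eq hle h.symm).symm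

section

variable [DecidableEq (Submodule F (Fin r → F))]

theorem image_finrank_flagSet (c : Composition r) (γ : GL (Fin r) R) :
    (flagSet (F := F) c γ).image (fun W : Submodule F (Fin r → F) => finrank F W) = innerSizes c := by
  rw [flagSet, Finset.image_image, innerSizes]
  exact Finset.image_congr fun i _ => finrank_flagSpace γ (c.sizeUpTo_le i)

theorem isChain_flagSet (c : Composition r) (γ : GL (Fin r) R) :
    IsChain (· ≤ ·) (flagSet (F := F) c γ : Set (Submodule F (Fin r → F))) := by
  intro A hA B hB _
  obtain ⟨i, -, rfl⟩ := Finset.mem_image.1 (Finset.mem_coe.1 hA)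
  obtain ⟨j, -, rfl⟩ := Finset.mem_image.1 (Finset.mem_coe.1 hB)
  exact (le_total (c.sizeUpTo i) (c.sizeUpTo j)).imp (fun h => flagSpace_mono F γ h)
    fun h => flagSpace_mono F γ h

/-- The unordered set suffices, since members of a chain are told apart by their dimensions. -/
theorem rightRel_of_flagSet_eq {c : Composition r} {γ γ' : GL (Fin r) R}
    (h : flagSet (F := F) c γ = flagSet c γ') :
    (QuotientGroup.rightRel (stdParabolic R c)).r γ γ' := by
  refine rightRel_of_flagSpace_eq (F := F) fun i hi => ?_
  have h1 : flagSpace F γ (c.sizeUpTo i) ∈ flagSet (F := F) c γ' :=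
    h ▸ Finset.mem_image_of_mem _ hi
  refine finrank_injOn_of_isChain (isChain_flagSet c γ') h1 (Finset.mem_image_of_mem _ hi) ?_
  change finrank F _ = finrank F _
  rw [finrank_flagSpace γ (c.sizeUpTo_le i), finrank_flagSpace γ' (c.sizeUpTo_le i)]

variable (R) in
/-- Every flag is attached to a coset. -/
theorem exists_flagSet_eq (hr : 0 < r) {c : Composition r} {T : Finset (Submodule F (Fin r → F))}
    (hT : IsChain (· ≤ ·) (T : Set (Submodule F (Fin r → F))))
    (hc : T.image (fun W : Submodule F (Fin r → F) => finrank F W) = innerSizes c) :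
    ∃ γ : GL (Fin r) R, flagSet c γ = T := by
  have hlen := length_pos hr c
  have hex : ∀ i ∈ Finset.Ico 1 c.length, ∃ A ∈ T, finrank F A = c.sizeUpTo i := fun i hi =>
    Finset.mem_image.1 (hc ▸ Finset.mem_image_of_mem _ hi)
  choose! A hAT hA using hex
  -- The flag is completed by `⊥` and `⊤`, so that an adapted basis of all of `R ^ r` exists.
  let W : ℕ → Submodule F (Fin r → F) := fun i =>
    if i = 0 then ⊥ else if i < c.length then A i else ⊤
  have hWA : ∀ i ∈ Finset.Ico 1 c.length, W i = A i := fun i hi => by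
    rw [Finset.mem_Ico] at hi
    simp only [W]
    rw [if_neg (by omega), if_pos hi.2]
  have hW0 : W 0 = ⊥ := if_pos rfl
  have hWtop : ∀ i, c.length ≤ i → W i = ⊤ := fun i hi => by
    simp only [W]
    rw [if_neg (by omega), if_neg (by omega)]
  have hmono : Monotone W := by
    refine monotone_nat_of_le_succ fun i => ?_
    rcases Nat.eq_zero_or_pos i with h | h
    · rw [h, hW0]
      exact bot_le
    · rcases le_or_gt c.length (i + 1) with h' | h'
      · rw [hWtop _ h']
        exact le_top
      · have h1 : i ∈ Finset.Ico 1 c.length := Finset.mem_Ico.2 ⟨h, by omega⟩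
        have h2 : i + 1 ∈ Finset.Ico 1 c.length := Finset.mem_Ico.2 ⟨by omega, h'⟩
        rw [hWA i h1, hWA _ h2]
        rcases hT.total (hAT i h1) (hAT _ h2) with h3 | h3
        · exact h3
        · have h4 := Submodule.finrank_mono h3
          rw [hA i h1, hA _ h2] at h4
          exact absurd h4 (not_le.2 (sizeUpTo_lt_sizeUpTo c i.lt_succ_self h'.le))
  obtain ⟨B, hB⟩ := exists_matrix_map_coordSpace R hmono hW0 (hWtop c.length le_rfl)
  have hflag : ∀ i ∈ Finset.Ico 1 c.length, flagSpace F B⁻¹ (c.sizeUpTo i) = A i := by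
    intro i hi
    have h1 := hB i (Finset.mem_Ico.1 hi).2.le
    rw [hWA i hi, hA i hi] at h1
    rw [← h1]
    have h2 : flagSpace F (B⁻¹ * B) (c.sizeUpTo i) = coordSpace F r (c.sizeUpTo i) := by
      rw [inv_mul_cancel]
      exact flagSpace_of_mem_stdParabolic (one_mem _) i
    rw [← h2, flagSpace_mul, Submodule.map_comap_eq_of_surjective (mulVecLin_bijective _).2]
  -- The inverse appears because the flag of `γ` is `γ⁻¹ F ^ k`.
  refine ⟨B⁻¹, Finset.Subset.antisymm (fun X hX => ?_) fun X hX => ?_⟩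
  · obtain ⟨i, hi, rfl⟩ := Finset.mem_image.1 hX
    rw [hflag i hi]
    exact hAT i hi
  · obtain ⟨i, hi, hXi⟩ := Finset.mem_image.1 (hc ▸ Finset.mem_image_of_mem (fun W :
      Submodule F (Fin r → F) => finrank F W) hX : finrank F X ∈ innerSizes c)
    have h1 : X = A i := finrank_injOn_of_isChain hT hX (hAT i hi) (by
      change finrank F X = finrank F (A i)
      rw [hA i hi, hXi])
    rw [h1, ← hflag i hi]
    exact Finset.mem_image_of_mem _ hi

end

end Flags

/-! ### The fundamental relation -/

section FundamentalRelation

variable {R F : Type*} [CommRing R] [IsDomain R] [IsPrincipalIdealRing R] [Field F]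
  [NumberField F] [Algebra R F] [IsFractionRing R F] {r : ℕ}

theorem vertex_flagSpace (g : GL (Fin r) 𝔸[F]) (γ : GL (Fin r) R) (k : ℕ) :
    vertex (toAdelic R F r γ * g) (coordSpace F r k) = vertex g (flagSpace F γ k) := by
  have h : toAdelic R F r γ =
      toAdelic F F r (Matrix.GeneralLinearGroup.map (algebraMap R F) γ) := by
    ext i j : 2
    rfl
  rw [h, ← map_flagSpace γ k, vertex_toAdelic_mul]

theorem nth_stdFiltration (c : Composition r) {i : ℕ} (hi : i ≤ c.length) :
    (stdFiltration F c).nth i = coordSpace F r (c.sizeUpTo i) :=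
  (stdFiltration F c).nth_eq (Nat.lt_succ_of_le hi)

theorem polygon_stdFiltration (hr : 0 < r) (g : GL (Fin r) 𝔸[F]) (c : Composition r) {i : ℕ}
    (hi : i ≤ c.length) : polygon g (stdFiltration F c) (c.sizeUpTo i) =
      vertex g (coordSpace F r (c.sizeUpTo i)) := by
  have h := polygon_finrank_nth hr g (stdFiltration F c) (j := i) hi
  rwa [nth_stdFiltration c hi, finrank_coordSpace F (c.sizeUpTo_le i)] at h

variable [DecidableEq (Submodule F (Fin r → F))]

theorem biggerWrt_iff (hr : 0 < r) {p : ℝ → ℝ} (hp : IsConvexNormalizedPolygon r p)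
    (g : GL (Fin r) 𝔸[F]) (c : Composition r) (γ : GL (Fin r) R) :
    BiggerWrt c (polygon (toAdelic R F r γ * g) (stdFiltration F c)) p ↔
      flagSet c γ ⊆ destabilizing hr hp g := by
  have key : ∀ i, i < c.length →
      (p (c.sizeUpTo i) < polygon (toAdelic R F r γ * g) (stdFiltration F c) (c.sizeUpTo i) ↔
        flagSpace F γ (c.sizeUpTo i) ∈ destabilizing hr hp g) := fun i hi => by
    rw [mem_destabilizing, polygon_stdFiltration hr _ c hi.le, vertex_flagSpace,
      finrank_flagSpace γ (c.sizeUpTo_le i)]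
  rw [flagSet, Finset.image_subset_iff]
  refine forall_congr' fun i => ?_
  rw [Finset.mem_Ico, and_imp]
  exact forall_congr' fun _ => forall_congr' fun hi => key i hi

/-- The nonzero terms of the inner sum for `c` are thus counted by the chains of destabilizing
subspaces with dimension set `innerSizes c`. -/
theorem bijOn_flagSet (hr : 0 < r) {p : ℝ → ℝ} (hp : IsConvexNormalizedPolygon r p)
    (g : GL (Fin r) 𝔸[F]) (c : Composition r) :
    Set.BijOn (fun δ : Cosets R c => flagSet c δ.out)
      {δ | BiggerWrt c (cosetPolygon R g c δ) p}
      {T : Finset (Submodule F (Fin r → F)) | (T ⊆ destabilizing hr hp g ∧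
        IsChain (· ≤ ·) (T : Set (Submodule F (Fin r → F)))) ∧
          T.image (fun W : Submodule F (Fin r → F) => finrank F W) = innerSizes c} := by
  have hiff : ∀ δ : Cosets R c, BiggerWrt c (cosetPolygon R g c δ) p ↔
      flagSet c δ.out ⊆ destabilizing hr hp g := fun δ => by
    rw [← biggerWrt_iff]
    conv_lhs => rw [← Quotient.out_eq δ]
    rfl
  refine ⟨fun δ hδ => ⟨⟨(hiff δ).1 hδ, isChain_flagSet c _⟩, image_finrank_flagSet c _⟩,
    fun δ _ δ' _ h => ?_, fun T hT => ?_⟩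
  · rw [← Quotient.out_eq δ, ← Quotient.out_eq δ']
    exact Quotient.sound (rightRel_of_flagSet_eq (F := F) h)
  · obtain ⟨γ, rfl⟩ := exists_flagSet_eq R hr hT.1.2 hT.2
    have h : flagSet (F := F) c (Quotient.out (Quotient.mk _ γ : Cosets R c)) = flagSet c γ := by
      refine Finset.image_congr fun i _ => flagSpace_eq_of_rightRel ?_ i
      exact Quotient.mk_out (s := QuotientGroup.rightRel (stdParabolic R c)) γ
    exact ⟨Quotient.mk _ γ, (hiff _).2 (h.symm ▸ hT.1.1), h⟩

end FundamentalRelation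

section

variable (R : Type*) {F : Type*} [CommRing R] [IsDomain R] [IsPrincipalIdealRing R] [Field F]
  [NumberField F] [Algebra R F] [IsFractionRing R F] {r : ℕ}

theorem finite_setOf_biggerWrt (hr : 0 < r) {p : ℝ → ℝ} (hp : IsConvexNormalizedPolygon r p)
    (g : GL (Fin r) 𝔸[F]) (c : Composition r) :
    {δ : Cosets R c | BiggerWrt c (cosetPolygon R g c δ) p}.Finite := by
  classical
  refine Set.Finite.of_injOn (bijOn_flagSet hr hp g c).mapsTo (bijOn_flagSet hr hp g c).injOn
    ((destabilizing hr hp g).powerset.finite_toSet.subset fun T hT => ?_)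
  exact Finset.mem_coe.2 (Finset.mem_powerset.2 hT.1.1)

open Classical in
theorem finsum_ind_biggerWrt (hr : 0 < r) {p : ℝ → ℝ} (hp : IsConvexNormalizedPolygon r p)
    (g : GL (Fin r) 𝔸[F]) (c : Composition r) :
    ∑ᶠ δ : Cosets R c, ind (BiggerWrt c (cosetPolygon R g c δ) p) =
      ∑ T ∈ (destabilizing hr hp g).powerset.filter
        (fun T : Finset (Submodule F (Fin r → F)) =>
          IsChain (· ≤ ·) (T : Set (Submodule F (Fin r → F)))),
          if innerSizes c = T.image (fun W : Submodule F (Fin r → F) => finrank F W)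
            then 1 else 0 := by
  have hbij := bijOn_flagSet (R := R) hr hp g c
  have h1 : ∀ δ : Cosets R c, ind (BiggerWrt c (cosetPolygon R g c δ) p) =
      ({δ | BiggerWrt c (cosetPolygon R g c δ) p} : Set (Cosets R c)).indicator 1 δ :=
    fun δ => rfl
  have h2 : {T : Finset (Submodule F (Fin r → F)) | (T ⊆ destabilizing hr hp g ∧
      IsChain (· ≤ ·) (T : Set (Submodule F (Fin r → F)))) ∧
        T.image (fun W : Submodule F (Fin r → F) => finrank F W) = innerSizes c} =
      (((destabilizing hr hp g).powerset.filter
        (fun T : Finset (Submodule F (Fin r → F)) =>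
          IsChain (· ≤ ·) (T : Set (Submodule F (Fin r → F))))).filter
          fun T => innerSizes c = T.image (fun W : Submodule F (Fin r → F) => finrank F W) :
            Finset _) := by
    ext T
    simp only [Set.mem_ofPred_eq, Finset.coe_filter, Finset.mem_filter, Finset.mem_powerset]
    exact and_congr_right fun _ => eq_comm
  rw [h2] at hbij
  simp_rw [h1]
  rw [← finsum_mem_def, finsum_mem_eq_of_bijOn (f := 1) (g := fun _ => 1) _ hbij fun _ _ => rfl,
    finsum_mem_coe_finset, Finset.sum_filter]

/-- The fundamental relation, for flags of `F ^ r` parametrized by matrices over a principal ideal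
domain with fraction field `F`. -/
theorem fundamentalRelation (hr : 0 < r) {p : ℝ → ℝ} (hp : IsConvexNormalizedPolygon r p)
    (g : GL (Fin r) 𝔸[F]) :
    ind (∀ x ∈ Set.Icc (0 : ℝ) r, canonicalPolygon g x ≤ p x) =
      ∑ c : Composition r, (-1) ^ (c.length - 1) *
        ∑ᶠ δ : Cosets R c, ind (BiggerWrt c (cosetPolygon R g c δ) p) := by
  classical
  simp_rw [finsum_ind_biggerWrt R hr hp g, Finset.mul_sum]
  rw [Finset.sum_comm, ind_canonicalPolygon_le hr hp g]
  refine Finset.sum_congr (by congr) fun T hT => ?_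
  rw [Finset.mem_filter, Finset.mem_powerset] at hT
  have hD : T.image (fun W : Submodule F (Fin r → F) => finrank F W) ⊆ Finset.Ioo 0 r :=
    Finset.image_subset_iff.2 fun W hW => finrank_mem_Ioo_of_mem_destabilizing (hT.1 hW)
  -- After the exchange of sums each chain contributes to one composition only, the one with its
  -- dimensions, for which `c.length - 1` is the cardinality of the chain.
  obtain ⟨c, hc, huniq⟩ := existsUnique_innerSizes_eq hr hD
  rw [Finset.sum_eq_single_of_mem c (Finset.mem_univ c), if_pos hc, mul_one, ← card_innerSizes, hc,
    Finset.card_image_of_injOn (finrank_injOn_of_isChain hT.2)]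
  intro c' _ hne
  rw [if_neg fun h => hne (huniq c' h), mul_zero]

end

end LatticeTruncation

end

theorem mainTheorem1 {r : ℕ} (hr : 0 < r) (p : ℝ → ℝ)
    (hp : LatticeTruncation.IsConvexNormalizedPolygon r p) :
    (∀ (F : Type*) [Field F] [NumberField F] (g : GL (Fin r) 𝔸[F]),
      (∃! 𝓕 : LatticeTruncation.Filtration F r, LatticeTruncation.IsCanonical g 𝓕) ∧
      (∀ c : Composition r, {δ : LatticeTruncation.Cosets F c |
        LatticeTruncation.BiggerWrt c (LatticeTruncation.cosetPolygon F g c δ) p}.Finite) ∧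
      LatticeTruncation.ind
          (∀ x ∈ Set.Icc (0 : ℝ) r, LatticeTruncation.canonicalPolygon g x ≤ p x) =
        ∑ c : Composition r, (-1) ^ (c.length - 1) *
          ∑ᶠ δ : LatticeTruncation.Cosets F c, LatticeTruncation.ind
            (LatticeTruncation.BiggerWrt c (LatticeTruncation.cosetPolygon F g c δ) p)) ∧
    (∀ g : GL (Fin r) 𝔸[ℚ],
      (∀ c : Composition r, {δ : LatticeTruncation.Cosets ℤ c |
        LatticeTruncation.BiggerWrt c (LatticeTruncation.cosetPolygon ℤ g c δ) p}.Finite) ∧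
      LatticeTruncation.ind
          (∀ x ∈ Set.Icc (0 : ℝ) r, LatticeTruncation.canonicalPolygon g x ≤ p x) =
        ∑ c : Composition r, (-1) ^ (c.length - 1) *
          ∑ᶠ δ : LatticeTruncation.Cosets ℤ c, LatticeTruncation.ind
            (LatticeTruncation.BiggerWrt c (LatticeTruncation.cosetPolygon ℤ g c δ) p)) := by
  exact ⟨fun F _ _ g => ⟨LatticeTruncation.existsUnique_isCanonical g,
      LatticeTruncation.finite_setOf_biggerWrt F hr hp g,
      LatticeTruncation.fundamentalRelation F hr hp g⟩,
    fun g => ⟨LatticeTruncation.finite_setOf_biggerWrt ℤ hr hp g,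
      LatticeTruncation.fundamentalRelation ℤ hr hp g⟩⟩
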